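/- Let $(P,\Omega)$ be a (finite-dimensional, $C^\infty$) symplectic manifold, with conventions $\Omega(X_f,\cdot)=df$ and $\{f,g\}=\Omega(X_f,X_g)$. Functions $\phi_i$ smooth on an open set $U$ *regularly define* $S$ on $U$ if $S=\{x\in U:\phi_i(x)=0\ \forall i\}$ and the $d\phi_i(x)$ are linearly independent for $x\in S$. Let $\phi_1,\dots,\phi_a$ be smooth on an open set $U\subseteq P$ and $a'\le a$; suppose $\phi_1,\dots,\phi_{a'}$ regularly define $S'$ (the primary constraint submanifold) and $\phi_1,\dots,\phi_a$ regularly define $S\subseteq S'$ (the final constraint submanifold) on $U$. Suppose the matrix $(\{\phi_i,\phi_j\}(x))_{1\le i,j\le a}$ has constant rank $2s$ on $U$ and the matrix $(\{\phi_i,\phi_j\}(x))_{1\le i\le a',\,1\le j\le a}$ has constant rank $s'$ on $S$. On an open set $W\subseteq U$: a *first class constraint* is a smooth $f$ on $W$ that vanishes on $S\cap W$ and has $X_f(x)\in T_xS$ for $x\in S\cap W$; it is *primary* if it vanishes on $S'\cap W$. A *complete set of first and second class constraints* on $W$ consists of functions $\psi_i,\chi_j$ that regularly define $S\cap W$ on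 $W$ and whose differentials are linearly independent on $W$, with every $\psi_i$ a first class constraint and $\det(\{\chi_i,\chi_j\}(x))\ne0$ on $W$. Let $(c^{ij})$ be the inverse of $(\{\chi_i,\chi_j\})$; the Dirac bracket is $\{F,G\}_{(\chi)}=\{F,G\}-\{F,\chi_i\}c^{ij}\{\chi_j,G\}$ and $X_{(\chi),F}=X_F-c^{ij}\{\chi_j,F\}X_{\chi_i}$ is the corresponding Hamiltonian vector field, so that $dG(X_{(\chi),F})=\{G,F\}_{(\chi)}$. (1) Near every point of $S$ one can choose $s'$ primary constraints $\chi'_1,\dots,\chi'_{s'}$ among $\phi_1,\dots,\phi_{a'}$ such that the rows $(\{\chi'_k,\phi_j\}(x))_{1\le j\le a}$ are linearly independent for all $x\in S$ near that point. (2) Let $V\subseteq U$ be open and let such a choice be given with the rows independent at all $x\in S\cap V$; renumber so that $\chi'_k=\phi_{a'-s'+k}$. Then there are smooth $\alpha_i^k$ on $V$ such that $\psi'_i=\phi_i+\alpha_i^k\chi'_k$, $i=1,\dots,a'-s'$, are (primary) first class constraints on $V$ and $(\psi',\chi')$ regularly define $S'\cap V$ on $V$. (3) For any such $\alpha$, every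 $x_0\in S\cap V$ has an open neighborhood $W\subseteq V$ on which $(\psi',\chi')$ is a complete set of primary constraints, with $\psi'$ a maximal independent family of primary first class constraints (the differentials of $\psi',\chi'$ are linearly independent on $W$, and for every primary first class constraint $f$ on $W$ there are smooth $b_i$ on $W$ with $df(x)=\sum_i b_i(x)\,d\psi'_i(x)$ for $x\in S\cap W$), and on which it extends to a complete set of first and second class constraints adapted to the primary constraints $$(\psi'_1,\dots,\psi'_{a'-s'},\psi''_{a'-s'+1},\dots,\psi''_{a-2s},\ \chi'_1,\dots,\chi'_{s'},\chi''_{s'+1},\dots,\chi''_{2s}),$$ where the $\chi''$ are chosen among $\phi_{a'+1},\dots,\phi_a$ and each $\psi''$ is one of the remaining $\phi_{a'+1},\dots,\phi_a$ plus a combination, with smooth coefficients, of the $\chi'$ and $\chi''$. (4) Let $W\subseteq V$ be open, let $(\psi',\psi'',\chi',\chi'')$ be any complete set of first and second class constraints on $W$ extending $(\psi',\chi')$ with the $\chi''$ chosen among $\phi_{a'+1},\dots,\phi_a$, and put $\psi=(\psi',\psi'')$, $\chi=(\chi',\chi'')$. Let $\mathcal E$ be a smooth function on $W$ (the energy) with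 $\{\mathcal E,\psi_i\}(x)=0$ for all $i$ and $x\in S\cap W$. For $\lambda'\in\mathbb R^{a'-s'}$ let $\mathcal E_{AT}=\mathcal E+\sum_{i=1}^{a'-s'}\lambda'^i\phi_i$ be the abridged total energy. Then on $W$ $$X_{(\chi),\mathcal E_{AT}}=X_{(\chi),\mathcal E}+\lambda'^iX_{(\chi),\phi_i},\qquad dF(X_{(\chi),\mathcal E_{AT}})=\{F,\mathcal E\}_{(\chi)}+\lambda'^i\{F,\phi_i\}_{(\chi)}\ \text{ for all smooth } F.$$ At points of $S\cap W$ this vector field is tangent to $S$, and the right-hand side of the second formula depends only on $F|_{S\cap W}$. (5) In the situation of (4), let $x\in S\cap W$ and let $\Lambda_x$ be the set of $\lambda\in\mathbb R^{a'}$ with $\{\mathcal E,\phi_j\}(x)+\sum_{i\le a'}\lambda^i\{\phi_i,\phi_j\}(x)=0$ for $j=1,\dots,a$. Assume $\Lambda_x\neq\emptyset$. Then for $\dot x\in T_xP$ the following are equivalent: (i) $\dot x$ satisfies the equations of motion, i.e. $\dot x\in T_xS$ and $\Omega(\dot x,\delta x)=d\mathcal E(\delta x)$ for all $\delta x\in T_xS'$;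 (ii) $\dot x=X_{\mathcal E}(x)+\sum_{i\le a'}\lambda^iX_{\phi_i}(x)$ for some $\lambda\in\Lambda_x$; (iii) $\dot x=X_{(\chi),\mathcal E_{AT}}(x)$ for a unique $\lambda'\in\mathbb R^{a'-s'}$; (iv) there is a unique $\lambda'\in\mathbb R^{a'-s'}$ such that $\dot F:=dF(\dot x)=\{F,\mathcal E\}_{(\chi)}(x)+\lambda'^i\{F,\phi_i\}_{(\chi)}(x)$ for all $F$ smooth at $x$. (6) If moreover $\Lambda_x\ne\emptyset$ for all $x\in S\cap W$, then for all constants $\lambda'$ there are smooth $\lambda^i$ on $W$, $i\le a'$, with $\lambda^i=\lambda'^i$ for $i\le a'-s'$ and $\lambda(x)\in\Lambda_x$ for $x\in S\cap W$. For any smooth $\lambda^i$ with $\lambda(x)\in\Lambda_x$ on $S\cap W$, the total energy $\mathcal E_T=\mathcal E+\sum_{i\le a'}\lambda^i\phi_i$ satisfies $X_{\mathcal E_T}(x)=X_{(\chi),\mathcal E_T}(x)=X_{(\chi),\mathcal E_{AT}}(x)$ at every $x\in S\cap W$, where $\mathcal E_{AT}$ is formed with the values $\lambda'^i=\lambda^i(x)$,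 $i\le a'-s'$. -/

import Mathlib

open scoped Manifold ContDiff

namespace DiracConstraints

noncomputable section

section Symplectic

variable {E : Type*} [NormedAddCommGroup E] [NormedSpace ℝ E]
  {P : Type*} [TopologicalSpace P] [ChartedSpace E P]

/-- The expression in the preferred chart at `c` of a field of bilinear forms on the tangent spaces
of `P`, i.e. its pullback to the model space by the inverse of that chart. -/
def chartForm (Ω : ∀ x : P, TangentSpace 𝓘(ℝ, E) x →L[ℝ] TangentSpace 𝓘(ℝ, E) x →L[ℝ] ℝ)
    (c : P) (y : E) : E →L[ℝ] E →L[ℝ] ℝ :=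
  let D : E →L[ℝ] TangentSpace 𝓘(ℝ, E) ((extChartAt 𝓘(ℝ, E) c).symm y) :=
    mfderiv 𝓘(ℝ, E) 𝓘(ℝ, E) (extChartAt 𝓘(ℝ, E) c).symm y
  (ContinuousLinearMap.precomp ℝ D).comp ((Ω ((extChartAt 𝓘(ℝ, E) c).symm y)).comp D)

variable (E P) in
/-- A symplectic form on `P`: a smooth, closed, nondegenerate 2-form. Smoothness and closedness
(`dΩ = 0`, written as a cyclic sum of derivatives of the components) are expressed in charts. -/
structure SymplecticForm where
  form : ∀ x : P, TangentSpace 𝓘(ℝ, E) x →L[ℝ] TangentSpace 𝓘(ℝ, E) x →L[ℝ] ℝ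
  alternating : ∀ (x : P) (v : TangentSpace 𝓘(ℝ, E) x), form x v v = 0
  nondegenerate : ∀ (x : P) (v : TangentSpace 𝓘(ℝ, E) x), (∀ w, form x v w = 0) → v = 0
  smooth : ∀ c : P, ContDiffOn ℝ ∞ (chartForm form c) (extChartAt 𝓘(ℝ, E) c).target
  closed : ∀ c : P, ∀ y ∈ (extChartAt 𝓘(ℝ, E) c).target, ∀ u v w : E,
    fderiv ℝ (chartForm form c) y u v w + fderiv ℝ (chartForm form c) y v w u
      + fderiv ℝ (chartForm form c) y w u v = 0

/-- `f` is smooth on the set `W`. -/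
abbrev SmoothOn (E : Type*) [NormedAddCommGroup E] [NormedSpace ℝ E]
    {P : Type*} [TopologicalSpace P] [ChartedSpace E P] (f : P → ℝ) (W : Set P) : Prop :=
  ContMDiffOn 𝓘(ℝ, E) 𝓘(ℝ, ℝ) ∞ f W

/-- The tangent space at `x` of a submanifold `S` of `P`: all velocities at `x` of curves in `S`
through `x`. The last condition says that `γ 0 = x` and that the velocity of `γ` at `0` is `v`. -/
def tangentTo (E : Type*) [NormedAddCommGroup E] [NormedSpace ℝ E]
    {P : Type*} [TopologicalSpace P] [ChartedSpace E P] (S : Set P) (x : P) :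
    Set (TangentSpace 𝓘(ℝ, E) x) :=
  {v | ∃ γ : ℝ → P, (∀ t, γ t ∈ S) ∧ MDifferentiableAt 𝓘(ℝ, ℝ) 𝓘(ℝ, E) γ 0 ∧
    (⟨γ 0, mfderiv 𝓘(ℝ, ℝ) 𝓘(ℝ, E) γ 0 (1 : ℝ)⟩ : TangentBundle 𝓘(ℝ, E) P) = ⟨x, v⟩}

/-- The functions `φ i`, smooth on the open set `W`, regularly define `S`: `S` is their common zero
set in `W`, and their differentials are linearly independent at the points of `S`. -/
structure RegularlyDefines (E : Type*) [NormedAddCommGroup E] [NormedSpace ℝ E]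
    {P : Type*} [TopologicalSpace P] [ChartedSpace E P] {ι : Type*}
    (φ : ι → P → ℝ) (W S : Set P) : Prop where
  isOpen : IsOpen W
  smooth : ∀ i, SmoothOn E (φ i) W
  zeroSet : S = {x | x ∈ W ∧ ∀ i, φ i x = 0}
  independent : ∀ x ∈ S, LinearIndependent ℝ (fun i => mvfderiv 𝓘(ℝ, E) (φ i) x)

end Symplectic

section Brackets

variable {E : Type*} [NormedAddCommGroup E] [NormedSpace ℝ E] [FiniteDimensional ℝ E]
  {P : Type*} [TopologicalSpace P] [ChartedSpace E P] (Ω : SymplecticForm E P)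

theorem SymplecticForm.form_bijective (x : P) : Function.Bijective (Ω.form x) := by
  have hinj : Function.Injective (Ω.form x) := by
    refine (injective_iff_map_eq_zero _).2 fun v hv => Ω.nondegenerate x v fun w => ?_
    rw [hv]
    rfl
  refine ⟨hinj, ?_⟩
  have hfin : FiniteDimensional ℝ E := inferInstance
  let f : E →ₗ[ℝ] (E →L[ℝ] ℝ) := (Ω.form x).toLinearMap
  have hcard : Module.finrank ℝ E = Module.finrank ℝ (E →L[ℝ] ℝ) := by
    rw [← (LinearMap.toContinuousLinearMap (𝕜 := ℝ) (E := E) (F' := ℝ)).finrank_eq]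
    exact (Subspace.dual_finrank_eq (K := ℝ) (V := E)).symm
  exact (LinearMap.injective_iff_surjective_of_finrank_eq_finrank (f := f) hcard).1 hinj

/-- The Hamiltonian vector field `X_f`, determined by `Ω(X_f, v) = df(v)` for all `v`. -/
def hamField (f : P → ℝ) (x : P) : TangentSpace 𝓘(ℝ, E) x :=
  (LinearEquiv.ofBijective (Ω.form x).toLinearMap (Ω.form_bijective x)).symm
    (mvfderiv 𝓘(ℝ, E) f x)

theorem form_hamField (f : P → ℝ) (x : P) :
    Ω.form x (hamField Ω f x) = mvfderiv 𝓘(ℝ, E) f x :=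
  (LinearEquiv.ofBijective (Ω.form x).toLinearMap (Ω.form_bijective x)).apply_symm_apply _

/-- The Poisson bracket `{f, g} = Ω(X_f, X_g)`. -/
def poisson (f g : P → ℝ) (x : P) : ℝ :=
  Ω.form x (hamField Ω f x) (hamField Ω g x)

/-- The matrix of Poisson brackets `{f i, g j}(x)`. -/
def bracketMatrix {ι κ : Type*} (f : ι → P → ℝ) (g : κ → P → ℝ) (x : P) : Matrix ι κ ℝ :=
  Matrix.of fun i j => poisson Ω (f i) (g j) x

/-- The Dirac bracket `{f, g} - ∑ {f, χ i} cⁱʲ {χ j, g}`, where `cⁱʲ` is the inverse of the matrix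
`{χ i, χ j}`. -/
def diracBracket {κ : Type*} [Fintype κ] [DecidableEq κ] (χ : κ → P → ℝ) (f g : P → ℝ) (x : P) :
    ℝ :=
  poisson Ω f g x -
    ∑ i, ∑ j, poisson Ω f (χ i) x * (bracketMatrix Ω χ χ x)⁻¹ i j * poisson Ω (χ j) g x

/-- The Hamiltonian vector field of `f` for the Dirac bracket: the vector field `X` such that
`dg(X) = {g, f}_(χ)` for all `g`. -/
def diracField {κ : Type*} [Fintype κ] [DecidableEq κ] (χ : κ → P → ℝ) (f : P → ℝ) (x : P) :
    TangentSpace 𝓘(ℝ, E) x :=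
  hamField Ω f x -
    ∑ i, ∑ j, ((bracketMatrix Ω χ χ x)⁻¹ i j * poisson Ω (χ j) f x) • hamField Ω (χ i) x

theorem mvfderiv_hamField (f g : P → ℝ) (x : P) :
    mvfderiv 𝓘(ℝ, E) g x (hamField Ω f x) = poisson Ω g f x := by
  rw [poisson, form_hamField]

theorem mvfderiv_diracField {κ : Type*} [Fintype κ] [DecidableEq κ] (χ : κ → P → ℝ)
    (f g : P → ℝ) (x : P) :
    mvfderiv 𝓘(ℝ, E) g x (diracField Ω χ f x) = diracBracket Ω χ g f x := by
  simp only [diracField, diracBracket, map_sub, map_sum, map_smul, mvfderiv_hamField, smul_eq_mul]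
  congr 1
  refine Finset.sum_congr rfl fun i _ => Finset.sum_congr rfl fun j _ => ?_
  ring

/-- `f` is a first class constraint for `S` on the open set `W`: it is smooth on `W`, vanishes on
`S`, and `X_f` is tangent to `S` along `S`. -/
structure IsFirstClassConstraint (S W : Set P) (f : P → ℝ) : Prop where
  smooth : SmoothOn E f W
  vanishes : ∀ x ∈ S ∩ W, f x = 0
  tangent : ∀ x ∈ S ∩ W, hamField Ω f x ∈ tangentTo E S x

/-- `(ψ, χ)` is a complete set of first class constraints `ψ` and second class constraints `χ` for
`S` on the open set `W`. -/
structure IsCompleteSet {ι κ : Type*} [Fintype κ] [DecidableEq κ] (S W : Set P)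
    (ψ : ι → P → ℝ) (χ : κ → P → ℝ) : Prop where
  regular : RegularlyDefines E (Sum.elim ψ χ) W (S ∩ W)
  independent : ∀ x ∈ W,
    LinearIndependent ℝ (fun k => mvfderiv 𝓘(ℝ, E) (Sum.elim ψ χ k) x)
  firstClass : ∀ i, IsFirstClassConstraint Ω S W (ψ i)
  secondClass : ∀ x ∈ W, (bracketMatrix Ω χ χ x).det ≠ 0

/-- The complete set `(ψ', ψ'', χ', χ'')` of first and second class constraints for `S` on `W` is
adapted to the primary constraint submanifold `S'`: the `ψ'` and `χ'` are primary constraints. -/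
structure IsAdaptedCompleteSet {ι' ι'' κ' κ'' : Type*} [Fintype κ'] [DecidableEq κ'] [Fintype κ'']
    [DecidableEq κ''] (S' S W : Set P) (ψ' : ι' → P → ℝ) (ψ'' : ι'' → P → ℝ)
    (χ' : κ' → P → ℝ) (χ'' : κ'' → P → ℝ) : Prop where
  complete : IsCompleteSet Ω S W (Sum.elim ψ' ψ'') (Sum.elim χ' χ'')
  primary_first : ∀ i, ∀ x ∈ S' ∩ W, ψ' i x = 0
  primary_second : ∀ i, ∀ x ∈ S' ∩ W, χ' i x = 0

/-- `(ψ', χ')` is a complete set of primary constraints on `W`, where `ψ'` is a maximal independent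
family of primary first class constraints: along `S` the differential of every primary first class
constraint is a linear combination, with smooth coefficients, of those of the `ψ'`. -/
structure IsCompletePrimarySet {ι κ : Type*} [Fintype ι] (S' S W : Set P)
    (ψ' : ι → P → ℝ) (χ' : κ → P → ℝ) : Prop where
  regular : RegularlyDefines E (Sum.elim ψ' χ') W (S' ∩ W)
  independent : ∀ x ∈ W,
    LinearIndependent ℝ (fun k => mvfderiv 𝓘(ℝ, E) (Sum.elim ψ' χ' k) x)
  firstClass : ∀ i, IsFirstClassConstraint Ω S W (ψ' i)
  maximal : ∀ f : P → ℝ, IsFirstClassConstraint Ω S W f → (∀ x ∈ S' ∩ W, f x = 0) →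
    ∃ b : ι → P → ℝ, (∀ i, SmoothOn E (b i) W) ∧
      ∀ x ∈ S ∩ W, mvfderiv 𝓘(ℝ, E) f x = ∑ i, b i x • mvfderiv 𝓘(ℝ, E) (ψ' i) x

/-- The velocity `v` at `x` solves the equations of motion for the energy `H`, with primary and
final constraint submanifolds `S'` and `S`: `v` is tangent to `S` and `Ω(v, δ) = dH(δ)` for all `δ`
tangent to `S'`. -/
def SolvesMotion (S' S : Set P) (H : P → ℝ) (x : P) (v : TangentSpace 𝓘(ℝ, E) x) : Prop :=
  v ∈ tangentTo E S x ∧ ∀ δ ∈ tangentTo E S' x, Ω.form x v δ = mvfderiv 𝓘(ℝ, E) H x δ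

/-- The multipliers `l` at `x` for which the total energy `H + ∑ lⁱ φ i`, summed over the primary
constraints, has vanishing Poisson bracket at `x` with all constraints. -/
def multipliers {ι κ : Type*} [Fintype ι] (φ : ι ⊕ κ → P → ℝ) (H : P → ℝ) (x : P) : Set (ι → ℝ) :=
  {l | ∀ j, poisson Ω H (φ j) x + ∑ i, l i * poisson Ω (φ (Sum.inl i)) (φ j) x = 0}

end Brackets

section Adapted

variable {P : Type*} {p q r t : ℕ} (φ : Fin p ⊕ Fin q → P → ℝ)

/-- The constraints `ψ' i = φ i + ∑ αᵢᵏ χ' k`, where `χ' k = φ (σ k)` are the chosen primary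
constraints and `i` runs through the other primary indices. -/
def primaryFirst (σ : Fin r ↪ Fin p) (α : {i // i ∉ Set.range σ} → Fin r → P → ℝ)
    (i : {i // i ∉ Set.range σ}) (x : P) : ℝ :=
  φ (Sum.inl i) x + ∑ k, α i k x * φ (Sum.inl (σ k)) x

/-- The constraints `ψ'' j = φ j + ∑ βⱼᵏ χ' k + ∑ γⱼˡ χ'' l`, where `χ' k = φ (σ k)` and
`χ'' l = φ (τ l)` are the chosen primary and secondary constraints and `j` runs through the other
secondary indices. -/
def secondaryFirst (σ : Fin r ↪ Fin p) (τ : Fin t ↪ Fin q)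
    (β : {j // j ∉ Set.range τ} → Fin r → P → ℝ) (γ : {j // j ∉ Set.range τ} → Fin t → P → ℝ)
    (j : {j // j ∉ Set.range τ}) (x : P) : ℝ :=
  φ (Sum.inr j) x + ∑ k, β j k x * φ (Sum.inl (σ k)) x + ∑ l, γ j l x * φ (Sum.inr (τ l)) x

/-- The chosen primary constraints `χ' k = φ (σ k)`. -/
def primarySecond (σ : Fin r ↪ Fin p) (k : Fin r) : P → ℝ := φ (Sum.inl (σ k))

/-- The chosen secondary constraints `χ'' l = φ (τ l)`. -/
def secondarySecond (τ : Fin t ↪ Fin q) (l : Fin t) : P → ℝ := φ (Sum.inr (τ l))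

/-- The abridged total energy `H + ∑ lⁱ φ i`, where `i` runs through the primary indices that are
not chosen by `σ`, with constant parameters `lⁱ`. -/
def abridgedEnergy (σ : Fin r ↪ Fin p) (H : P → ℝ) (l : {i // i ∉ Set.range σ} → ℝ) (x : P) : ℝ :=
  H x + ∑ i, l i * φ (Sum.inl i.1) x

end Adapted

end

end DiracConstraints

namespace DiracConstraints

open Filter Topology

/-! ### Differentials of sums and products of functions. -/

section Calculus

variable {E : Type*} [NormedAddCommGroup E] [NormedSpace ℝ E]
  {P : Type*} [TopologicalSpace P] [ChartedSpace E P]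

/-! The implicit function theorem identifies the tangent space of a regularly defined submanifold
with the common kernel of the differentials (`RegularlyDefines.mem_tangentTo_iff`). Thereafter
everything on S is linear algebra at a point: a function vanishing on S is first class iff its
brackets with all φ_j vanish on S, so first class combinations of constraints are linear relations
between rows of the bracket matrix.

Where s' selected rows span the primary rows, every other primary row is a combination of them, and
subtracting that combination from φ_i gives ψ'_i. Smooth coefficients come from
`exists_smoothOn_coefficients`: they are computed with the Gram matrix of the rows, and a function N
that is zero on S and positive elsewhere keeps the denominator away from zero, so one formula works
on all of V without partitions of unity.

For the complete set, the selected rows are extended by secondary rows to a basis of the full row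
space. The bracket matrix is antisymmetric, so the principal minor on a row basis is invertible
(`det_ne_zero_of_antisymm`) and the selected functions are second class; the remaining secondary
constraints are corrected as before. The family ψ' is maximal because the differential of a primary
first class constraint is a combination of the dψ' and dχ', and evaluation on the X_{φ_j} removes
the dχ'.

For the dynamics, Ω(v,·) − dH annihilates the tangent space of S' iff it is a combination of the
primary differentials, and tangency of v to S is then exactly the condition on the multipliers.
Under this condition the total energy has vanishing brackets with all χ, so its Hamiltonian and
Dirac fields agree; the χ' are Casimirs of the Dirac bracket, so only the unselected multipliers
survive. These are uniquely determined by v, since on S the Dirac field of φ_i is X_{ψ'_i} and the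
dψ'_i are independent. They are also arbitrary, since adding multiples of the ψ'_i to the total
energy does not affect the multiplier condition (`exists_multipliers_extending`). -/

theorem mdifferentiableAt_of_contMDiffAt {f : P → ℝ} {x : P}
    (hf : ContMDiffAt 𝓘(ℝ, E) 𝓘(ℝ, ℝ) ∞ f x) : MDifferentiableAt 𝓘(ℝ, E) 𝓘(ℝ, ℝ) f x :=
  hf.mdifferentiableAt (by simp)

theorem SmoothOn.mdifferentiableAt {f : P → ℝ} {W : Set P} (hf : SmoothOn E f W) (hW : IsOpen W)
    {x : P} (hx : x ∈ W) : MDifferentiableAt 𝓘(ℝ, E) 𝓘(ℝ, ℝ) f x :=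
  mdifferentiableAt_of_contMDiffAt (hf.contMDiffAt (hW.mem_nhds hx))

theorem mvfderiv_congr {f g : P → ℝ} {x : P} (h : f =ᶠ[𝓝 x] g) :
    mvfderiv 𝓘(ℝ, E) f x = mvfderiv 𝓘(ℝ, E) g x := by
  ext v
  simp only [mvfderiv, h.mfderiv_eq]
  rfl

theorem mvfderiv_sum {ι : Type*} (s : Finset ι) {f : ι → P → ℝ} {x : P}
    (hf : ∀ i ∈ s, MDifferentiableAt 𝓘(ℝ, E) 𝓘(ℝ, ℝ) (f i) x) :
    MDifferentiableAt 𝓘(ℝ, E) 𝓘(ℝ, ℝ) (fun y => ∑ i ∈ s, f i y) x ∧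
    mvfderiv 𝓘(ℝ, E) (fun y => ∑ i ∈ s, f i y) x = ∑ i ∈ s, mvfderiv 𝓘(ℝ, E) (f i) x := by
  classical
  induction s using Finset.induction_on with
  | empty =>
    simp only [Finset.sum_empty]
    exact ⟨mdifferentiableAt_const, mvfderiv_const _⟩
  | insert a s ha ih =>
    have h1 := ih fun i hi => hf i (Finset.mem_insert_of_mem hi)
    have h2 := hf a (Finset.mem_insert_self a s)
    simp only [Finset.sum_insert ha]
    refine ⟨h2.add h1.1, ?_⟩
    rw [mvfderiv_fun_add h2 h1.1, h1.2]

/-- The differential of a sum of products at a point where the second factors vanish. -/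
theorem mvfderiv_add_sum_mul_of_eq_zero {ι : Type*} [Fintype ι] {h : P → ℝ} {a g : ι → P → ℝ}
    {x : P} (hh : MDifferentiableAt 𝓘(ℝ, E) 𝓘(ℝ, ℝ) h x)
    (ha : ∀ i, MDifferentiableAt 𝓘(ℝ, E) 𝓘(ℝ, ℝ) (a i) x)
    (hg : ∀ i, MDifferentiableAt 𝓘(ℝ, E) 𝓘(ℝ, ℝ) (g i) x) (h0 : ∀ i, g i x = 0) :
    mvfderiv 𝓘(ℝ, E) (fun y => h y + ∑ i, a i y * g i y) x
      = mvfderiv 𝓘(ℝ, E) h x + ∑ i, a i x • mvfderiv 𝓘(ℝ, E) (g i) x := by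
  have hs := mvfderiv_sum Finset.univ (x := x) (f := fun i y => a i y * g i y)
    fun i _ => (ha i).mul (hg i)
  rw [mvfderiv_fun_add hh hs.1, hs.2]
  congr 1
  refine Finset.sum_congr rfl fun i _ => ?_
  rw [mvfderiv_fun_mul (ha i) (hg i), h0 i, zero_smul, add_zero]

theorem mvfderiv_add_sum_const_mul {ι : Type*} [Fintype ι] {h : P → ℝ} (a : ι → ℝ)
    {g : ι → P → ℝ} {x : P} (hh : MDifferentiableAt 𝓘(ℝ, E) 𝓘(ℝ, ℝ) h x)
    (hg : ∀ i, MDifferentiableAt 𝓘(ℝ, E) 𝓘(ℝ, ℝ) (g i) x) :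
    mvfderiv 𝓘(ℝ, E) (fun y => h y + ∑ i, a i * g i y) x
      = mvfderiv 𝓘(ℝ, E) h x + ∑ i, a i • mvfderiv 𝓘(ℝ, E) (g i) x := by
  have hs := mvfderiv_sum Finset.univ (x := x) (f := fun i y => a i * g i y)
    fun i _ => mdifferentiableAt_const.mul (hg i)
  rw [mvfderiv_fun_add hh hs.1, hs.2]
  congr 1
  refine Finset.sum_congr rfl fun i _ => ?_
  rw [mvfderiv_fun_mul mdifferentiableAt_const (hg i), mvfderiv_const, smul_zero, add_zero]

end Calculus

/-! ### Reading functions and differentials in charts. -/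

section Charts

variable {E : Type*} [NormedAddCommGroup E] [NormedSpace ℝ E]
  {P : Type*} [TopologicalSpace P] [ChartedSpace E P] [IsManifold 𝓘(ℝ, E) ∞ P]

theorem isManifold_one : IsManifold 𝓘(ℝ, E) 1 P :=
  IsManifold.of_le (m := 1) (n := ∞) (by norm_num)

theorem contMDiffAt_extChartAt_symm (c : P) {z : E} (hz : z ∈ (extChartAt 𝓘(ℝ, E) c).target) :
    ContMDiffAt 𝓘(ℝ, E) 𝓘(ℝ, E) ∞ (extChartAt 𝓘(ℝ, E) c).symm z :=
  (contMDiffOn_extChartAt_symm c).contMDiffAt ((isOpen_extChartAt_target c).mem_nhds hz)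

theorem contDiffAt_comp_extChartAt_symm (c : P) {f : P → ℝ} {z : E}
    (hz : z ∈ (extChartAt 𝓘(ℝ, E) c).target)
    (hf : ContMDiffAt 𝓘(ℝ, E) 𝓘(ℝ, ℝ) ∞ f ((extChartAt 𝓘(ℝ, E) c).symm z)) :
    ContDiffAt ℝ ∞ (f ∘ (extChartAt 𝓘(ℝ, E) c).symm) z :=
  (hf.comp z (contMDiffAt_extChartAt_symm c hz)).contDiffAt

theorem isInvertible_mfderiv_extChartAt_symm (c : P) {z : E}
    (hz : z ∈ (extChartAt 𝓘(ℝ, E) c).target) :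
    (mfderiv 𝓘(ℝ, E) 𝓘(ℝ, E) (extChartAt 𝓘(ℝ, E) c).symm z).IsInvertible := by
  have := isManifold_one (E := E) (P := P)
  have h := isInvertible_mfderivWithin_extChartAt_symm hz
  rwa [ModelWithCorners.range_eq_univ, mfderivWithin_univ] at h

theorem fderiv_comp_extChartAt_symm (c : P) {f : P → ℝ} {z : E}
    (hz : z ∈ (extChartAt 𝓘(ℝ, E) c).target)
    (hf : MDifferentiableAt 𝓘(ℝ, E) 𝓘(ℝ, ℝ) f ((extChartAt 𝓘(ℝ, E) c).symm z)) (v : E) :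
    fderiv ℝ (f ∘ (extChartAt 𝓘(ℝ, E) c).symm) z v
      = mvfderiv 𝓘(ℝ, E) f ((extChartAt 𝓘(ℝ, E) c).symm z)
        (mfderiv 𝓘(ℝ, E) 𝓘(ℝ, E) (extChartAt 𝓘(ℝ, E) c).symm z v) := by
  have h := mfderiv_comp_apply z hf
    ((contMDiffAt_extChartAt_symm c hz).mdifferentiableAt (by simp)) v
  rw [mfderiv_eq_fderiv] at h
  exact h

omit [IsManifold 𝓘(ℝ, E) ∞ P] in
theorem fderiv_comp_extChartAt_symm_self (x : P) {f : P → ℝ}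
    (hf : MDifferentiableAt 𝓘(ℝ, E) 𝓘(ℝ, ℝ) f x) :
    fderiv ℝ (f ∘ (extChartAt 𝓘(ℝ, E) x).symm) (extChartAt 𝓘(ℝ, E) x x)
      = mvfderiv 𝓘(ℝ, E) f x := by
  have h := hf.mvfderiv
  rw [ModelWithCorners.range_eq_univ, fderivWithin_univ] at h
  exact h.symm

/-- Every covector is the differential of a function that is smooth near the given point. -/
theorem exists_smoothOn_mvfderiv_eq (x : P) :
    ∃ W : Set P, IsOpen W ∧ x ∈ W ∧ ∀ ξ : TangentSpace 𝓘(ℝ, E) x →L[ℝ] ℝ, ∃ F : P → ℝ,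
      SmoothOn E F W ∧ mvfderiv 𝓘(ℝ, E) F x = ξ := by
  have := isManifold_one (E := E) (P := P)
  -- The domain is that of the chart, fixed before the covector, so it serves finitely or infinitely
  -- many covectors at once. Composing a covector with the chart suffices because the differential
  -- of the chart at its own base point is the identity.
  refine ⟨(chartAt E x).source, (chartAt E x).open_source, mem_chart_source E x, fun ξ => ?_⟩
  let ξ' : E →L[ℝ] ℝ := ξ
  refine ⟨fun y => ξ' (extChartAt 𝓘(ℝ, E) x y), ?_, ?_⟩
  · exact ξ'.contMDiff.comp_contMDiffOn contMDiffOn_extChartAt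
  · ext v
    have h1 := mfderiv_comp_apply (I'' := 𝓘(ℝ, ℝ)) (g := ξ') x
      ξ'.mdifferentiableAt
      (mdifferentiableAt_extChartAt (I := 𝓘(ℝ, E)) (mem_chart_source E x)) v
    rw [mfderiv_extChartAt_self, mfderiv_eq_fderiv] at h1
    erw [ContinuousLinearMap.fderiv] at h1
    exact h1

/-- A tangent vector is determined by the derivatives of smooth functions along it. -/
theorem eq_iff_forall_mvfderiv_eq {x : P} {v w : TangentSpace 𝓘(ℝ, E) x} :
    v = w ↔ ∀ F : P → ℝ, ContMDiffAt 𝓘(ℝ, E) 𝓘(ℝ, ℝ) ∞ F x →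
      mvfderiv 𝓘(ℝ, E) F x v = mvfderiv 𝓘(ℝ, E) F x w := by
  refine ⟨fun h _ _ => by rw [h], fun h => ?_⟩
  obtain ⟨W, hW, hxW, hF⟩ := exists_smoothOn_mvfderiv_eq (E := E) x
  refine (SeparatingDual.eq_iff_forall_dual_eq (R := ℝ) (V := E)).2 fun ξ => ?_
  obtain ⟨F, hFs, hFd⟩ := hF ξ
  have h1 := h F (hFs.contMDiffAt (hW.mem_nhds hxW))
  rw [hFd] at h1
  exact h1

end Charts

/-! ### Smoothness of Poisson brackets. -/

section Smoothness

variable {E : Type*} [NormedAddCommGroup E] [NormedSpace ℝ E] [FiniteDimensional ℝ E]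
  {P : Type*} [TopologicalSpace P] [ChartedSpace E P] [IsManifold 𝓘(ℝ, E) ∞ P]
  (Ω : SymplecticForm E P)

/-- The coordinate expression df(ω⁻¹ dg) of the bracket. Inversion of continuous linear maps is
smooth at invertible ones, so this formula turns smoothness of the form into smoothness of brackets
in `SmoothOn.poisson`. -/
theorem poisson_extChartAt_symm (c : P) {z : E} (hz : z ∈ (extChartAt 𝓘(ℝ, E) c).target)
    {f g : P → ℝ}
    (hf : MDifferentiableAt 𝓘(ℝ, E) 𝓘(ℝ, ℝ) f ((extChartAt 𝓘(ℝ, E) c).symm z))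
    (hg : MDifferentiableAt 𝓘(ℝ, E) 𝓘(ℝ, ℝ) g ((extChartAt 𝓘(ℝ, E) c).symm z)) :
    (chartForm Ω.form c z).IsInvertible ∧
    poisson Ω f g ((extChartAt 𝓘(ℝ, E) c).symm z)
      = fderiv ℝ (f ∘ (extChartAt 𝓘(ℝ, E) c).symm) z
        ((chartForm Ω.form c z).inverse (fderiv ℝ (g ∘ (extChartAt 𝓘(ℝ, E) c).symm) z)) := by
  obtain ⟨D, hD⟩ := isInvertible_mfderiv_extChartAt_symm c hz
  have hinj : Function.Injective (chartForm Ω.form c z) := by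
    refine (injective_iff_map_eq_zero _).2 fun v hv => ?_
    have h0 : D v = 0 := Ω.nondegenerate _ _ fun w => by
      have h1 : chartForm Ω.form c z v (D.symm w) = 0 := by rw [hv]; rfl
      have h2 : chartForm Ω.form c z v (D.symm w)
          = Ω.form ((extChartAt 𝓘(ℝ, E) c).symm z)
            (mfderiv 𝓘(ℝ, E) 𝓘(ℝ, E) (extChartAt 𝓘(ℝ, E) c).symm z v)
            (mfderiv 𝓘(ℝ, E) 𝓘(ℝ, E) (extChartAt 𝓘(ℝ, E) c).symm z (D.symm w)) := rfl
      rw [h2, ← hD] at h1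
      erw [D.apply_symm_apply] at h1
      exact h1
    exact D.map_eq_zero_iff.1 h0
  have hfin : Module.finrank ℝ E = Module.finrank ℝ (E →L[ℝ] ℝ) := by
    rw [← (LinearMap.toContinuousLinearMap (𝕜 := ℝ) (E := E) (F' := ℝ)).finrank_eq]
    exact (Subspace.dual_finrank_eq (K := ℝ) (V := E)).symm
  have hinv : (chartForm Ω.form c z).IsInvertible :=
    ⟨(LinearEquiv.ofBijective (chartForm Ω.form c z).toLinearMap ⟨hinj,
      (LinearMap.injective_iff_surjective_of_finrank_eq_finrank
        (f := (chartForm Ω.form c z).toLinearMap) hfin).1 hinj⟩).toContinuousLinearEquiv, by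
      ext; rfl⟩
  refine ⟨hinv, ?_⟩
  obtain ⟨A, hA⟩ := hinv
  -- The Hamiltonian vector of g, pulled back to the model space; the chart form sends it to the
  -- differential of g in the chart.
  let X : E := D.symm (hamField Ω g ((extChartAt 𝓘(ℝ, E) c).symm z))
  have hDX : mfderiv 𝓘(ℝ, E) 𝓘(ℝ, E) (extChartAt 𝓘(ℝ, E) c).symm z X
      = hamField Ω g ((extChartAt 𝓘(ℝ, E) c).symm z) := by
    rw [← hD]
    exact D.apply_symm_apply _
  have hX : chartForm Ω.form c z X = fderiv ℝ (g ∘ (extChartAt 𝓘(ℝ, E) c).symm) z := by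
    ext w
    rw [fderiv_comp_extChartAt_symm c hz hg, ← form_hamField, ← hDX]
    rfl
  have hX' : (chartForm Ω.form c z).inverse
      (fderiv ℝ (g ∘ (extChartAt 𝓘(ℝ, E) c).symm) z) = X := by
    rw [← hX, ← hA, ContinuousLinearMap.inverse_equiv]
    exact A.symm_apply_apply X
  rw [hX', fderiv_comp_extChartAt_symm c hz hf, hDX, mvfderiv_hamField]

theorem SmoothOn.poisson {f g : P → ℝ} {W : Set P} (hW : IsOpen W) (hf : SmoothOn E f W)
    (hg : SmoothOn E g W) : SmoothOn E (poisson Ω f g) W := by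
  intro x hxW
  refine ContMDiffAt.contMDiffWithinAt ?_
  have := isManifold_one (E := E) (P := P)
  have hfx := hf.contMDiffAt (hW.mem_nhds hxW)
  have hgx := hg.contMDiffAt (hW.mem_nhds hxW)
  let e := extChartAt 𝓘(ℝ, E) x
  have hx : x ∈ e.source := mem_extChartAt_source x
  have hz : e x ∈ e.target := e.map_source hx
  have hsx : e.symm (e x) = x := e.left_inv hx
  have hf' := contDiffAt_comp_extChartAt_symm x hz (hsx.symm ▸ hfx)
  have hg' := contDiffAt_comp_extChartAt_symm x hz (hsx.symm ▸ hgx)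
  have hinv := (poisson_extChartAt_symm Ω x hz
    (hsx.symm ▸ mdifferentiableAt_of_contMDiffAt hfx)
    (hsx.symm ▸ mdifferentiableAt_of_contMDiffAt hgx)).1
  have hform : ContDiffAt ℝ ∞ (chartForm Ω.form x) (e x) :=
    (Ω.smooth x).contDiffAt ((isOpen_extChartAt_target x).mem_nhds hz)
  have hloc : ContDiffAt ℝ ∞ (fun z => fderiv ℝ (f ∘ e.symm) z
      ((chartForm Ω.form x z).inverse (fderiv ℝ (g ∘ e.symm) z))) (e x) :=
    (hf'.fderiv_right (by simp)).clm_apply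
      ((hinv.contDiffAt_map_inverse.comp (e x) hform).clm_apply (hg'.fderiv_right (by simp)))
  refine (hloc.contMDiffAt.comp x contMDiffAt_extChartAt).congr_of_eventuallyEq ?_
  filter_upwards [hW.mem_nhds hxW, extChartAt_source_mem_nhds (I := 𝓘(ℝ, E)) x] with y hyW hy
  have hsy : e.symm (e y) = y := e.left_inv hy
  have h := (poisson_extChartAt_symm Ω x (f := f) (g := g) (e.map_source hy)
    (hsy.symm ▸ SmoothOn.mdifferentiableAt hf hW hyW)
    (hsy.symm ▸ SmoothOn.mdifferentiableAt hg hW hyW)).2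
  rw [hsy] at h
  exact h

end Smoothness

/-! ### Tangent spaces of regularly defined submanifolds. -/

section Tangent

variable {E : Type*} [NormedAddCommGroup E] [NormedSpace ℝ E]
  {P : Type*} [TopologicalSpace P] [ChartedSpace E P]

/-- A function that vanishes on `S` near `x` is stationary along `S`. -/
theorem mvfderiv_eq_zero_of_mem_tangentTo {S : Set P} {x : P} {f : P → ℝ}
    (hf : MDifferentiableAt 𝓘(ℝ, E) 𝓘(ℝ, ℝ) f x) (h : ∀ᶠ y in 𝓝 x, y ∈ S → f y = 0)
    {v : TangentSpace 𝓘(ℝ, E) x} (hv : v ∈ tangentTo E S x) : mvfderiv 𝓘(ℝ, E) f x v = 0 := by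
  obtain ⟨γ, hγS, hγ, hγv⟩ := hv
  cases hγv
  have h1 := mvfderiv_comp_apply (I := 𝓘(ℝ, E)) (I' := 𝓘(ℝ, ℝ)) (0 : ℝ) hf hγ (1 : ℝ)
  rw [← h1]
  have h2 : f ∘ γ =ᶠ[𝓝 0] fun _ => (0 : ℝ) := by
    filter_upwards [hγ.continuousAt.eventually h] with t ht
    exact ht (hγS t)
  rw [mvfderiv_congr h2, mvfderiv_const]
  rfl

theorem tangentTo_mono {S T : Set P} (h : S ⊆ T) (x : P) :
    tangentTo E S x ⊆ tangentTo E T x := fun _ ⟨γ, h1, h2⟩ => ⟨γ, fun t => h (h1 t), h2⟩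

/-- A proper range would lie in the kernel of a nonzero functional on ℝ^ι, whose coefficients would
be a nontrivial relation between the ξ. -/
theorem surjective_pi_of_linearIndependent {V : Type*} [AddCommGroup V] [Module ℝ V]
    {ι : Type*} [Fintype ι] {ξ : ι → V →ₗ[ℝ] ℝ} (h : LinearIndependent ℝ ξ) :
    Function.Surjective (LinearMap.pi ξ) := by
  rw [← LinearMap.range_eq_top]
  by_contra hne
  classical
  obtain ⟨f, hf0, hf⟩ := Submodule.exists_le_ker_of_lt_top _ (lt_top_iff_ne_top.2 hne)
  have hsum : ∑ i, f (Pi.single i 1) • ξ i = 0 := by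
    ext v
    have hv : f (LinearMap.pi ξ v) = 0 := hf ⟨v, rfl⟩
    rw [LinearMap.pi_apply_eq_sum_univ f] at hv
    simp only [LinearMap.sum_apply, LinearMap.smul_apply, smul_eq_mul, LinearMap.zero_apply]
    rw [← hv]
    refine Finset.sum_congr rfl fun i _ => ?_
    rw [LinearMap.pi_apply, smul_eq_mul, mul_comm]
    congr 2
    funext j
    simp [Pi.single_apply, eq_comm]
  have hc := Fintype.linearIndependent_iff.1 h _ hsum
  refine hf0 (LinearMap.pi_ext' fun i => LinearMap.ext_ring ?_)
  simpa using hc i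

theorem tangentBundle_mk_eq {x y : P} {v : TangentSpace 𝓘(ℝ, E) x} {w : TangentSpace 𝓘(ℝ, E) y}
    (hxy : x = y) (hvw : (v : E) = (w : E)) :
    (⟨x, v⟩ : TangentBundle 𝓘(ℝ, E) P) = ⟨y, w⟩ := by
  subst hxy
  exact congrArg _ hvw

variable [IsManifold 𝓘(ℝ, E) ∞ P] [FiniteDimensional ℝ E]

/-- The tangent space of a regularly defined submanifold is the common kernel of the differentials
of the defining functions. -/
theorem RegularlyDefines.mem_tangentTo_iff {ι : Type*} [Fintype ι] {φ : ι → P → ℝ} {U S : Set P}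
    (h : RegularlyDefines E φ U S) {x : P} (hx : x ∈ S) {v : TangentSpace 𝓘(ℝ, E) x} :
    v ∈ tangentTo E S x ↔ ∀ i, mvfderiv 𝓘(ℝ, E) (φ i) x v = 0 := by
  have hmem : ∀ y, y ∈ S ↔ y ∈ U ∧ ∀ i, φ i y = 0 := fun y => by
    conv_lhs => rw [h.zeroSet]
    rfl
  have hxU := ((hmem x).1 hx).1
  refine ⟨fun hv i => mvfderiv_eq_zero_of_mem_tangentTo
    (SmoothOn.mdifferentiableAt (h.smooth i) h.isOpen hxU)
    (Eventually.of_forall fun y hy => ((hmem y).1 hy).2 i) hv, fun hv => ?_⟩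
  have := isManifold_one (E := E) (P := P)
  have : CompleteSpace E := FiniteDimensional.complete ℝ E
  let e := extChartAt 𝓘(ℝ, E) x
  have hxe : x ∈ e.source := mem_extChartAt_source x
  have hz : e x ∈ e.target := e.map_source hxe
  have hsx : e.symm (e x) = x := e.left_inv hxe
  have hφ : ∀ i, MDifferentiableAt 𝓘(ℝ, E) 𝓘(ℝ, ℝ) (φ i) x := fun i =>
    SmoothOn.mdifferentiableAt (h.smooth i) h.isOpen hxU
  let f : E → ι → ℝ := fun z i => φ i (e.symm z)
  have hfd : ContDiffAt ℝ ∞ f (e x) := contDiffAt_pi.2 fun i =>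
    contDiffAt_comp_extChartAt_symm x hz
      (hsx.symm ▸ (h.smooth i).contMDiffAt (h.isOpen.mem_nhds hxU))
  let f' : E →L[ℝ] ι → ℝ := ContinuousLinearMap.pi fun i => mvfderiv 𝓘(ℝ, E) (φ i) x
  have hf : HasStrictFDerivAt f f' (e x) := by
    refine hasStrictFDerivAt_pi.2 fun i => ?_
    have h1 := (contDiffAt_pi.1 hfd i).hasStrictFDerivAt (by simp)
    have h2 := fderiv_comp_extChartAt_symm_self x (hφ i)
    exact h2 ▸ h1
  have hind : LinearIndependent ℝ fun i => (mvfderiv 𝓘(ℝ, E) (φ i) x : E →L[ℝ] ℝ) :=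
    h.independent x hx
  have hrange : f'.range = ⊤ := by
    refine LinearMap.range_eq_top.2 (surjective_pi_of_linearIndependent
      (V := E) (ξ := fun i => (mvfderiv 𝓘(ℝ, E) (φ i) x : E →L[ℝ] ℝ).toLinearMap) ?_)
    exact hind.map' (ContinuousLinearMap.coeLM ℝ)
      (LinearMap.ker_eq_bot.2 ContinuousLinearMap.coe_injective)
  have hvker : (v : E) ∈ f'.ker := funext hv
  let w : f'.ker := ⟨v, hvker⟩
  -- The implicit function parametrizes the level set by the kernel of the differential, to first
  -- order by the inclusion; the line through w therefore lifts to a curve in the level set with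
  -- velocity v.
  let g : ℝ → E := fun t => hf.implicitFunction f f' hrange (f (e x)) (t • w)
  have hg0 : g 0 = e x := by
    simp only [g, zero_smul]
    exact hf.implicitFunction_apply_image hrange
  have hgd : HasDerivAt g (v : E) 0 := by
    have h1 : HasDerivAt (fun t : ℝ => t • w) w 0 := by
      simpa using (hasDerivAt_id (0 : ℝ)).smul_const w
    have h2 := (hf.to_implicitFunction hrange).hasFDerivAt
    rw [show (0 : f'.ker) = (0 : ℝ) • w by simp] at h2
    exact h2.comp_hasDerivAt (0 : ℝ) h1
  have hcont : ContinuousAt e.symm (g 0) := by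
    rw [hg0]
    exact (contMDiffAt_extChartAt_symm x hz).continuousAt
  have hg_mem : ∀ᶠ t in 𝓝 (0 : ℝ), e.symm (g t) ∈ S := by
    have h1 : ∀ᶠ t in 𝓝 (0 : ℝ), e.symm (g t) ∈ U :=
      (hcont.comp hgd.continuousAt).eventually
        (h.isOpen.mem_nhds (by simpa [hg0, hsx] using hxU))
    have h2 : ∀ᶠ t in 𝓝 (0 : ℝ), f (g t) = f (e x) := by
      have h3 : ContinuousAt (fun t : ℝ => ((f (e x), t • w) : (ι → ℝ) × f'.ker)) 0 := by
        fun_prop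
      have h4 := hf.map_implicitFunction_eq hrange
      rw [show ((f (e x), 0) : (ι → ℝ) × f'.ker) = (f (e x), (0 : ℝ) • w) by simp] at h4
      exact h3.eventually h4
    filter_upwards [h1, h2] with t ht1 ht2
    refine (hmem _).2 ⟨ht1, fun i => ?_⟩
    have h5 := congrFun ht2 i
    simp only [f, hsx] at h5
    rw [h5]
    exact ((hmem x).1 hx).2 i
  classical
  -- The curve must stay in S for all times, whereas the lifted one does so only near 0. The
  -- constant x is a harmless value elsewhere.
  let γ : ℝ → P := fun t => if e.symm (g t) ∈ S then e.symm (g t) else x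
  have hγ0 : γ 0 = x := by simp [γ, hg0, hsx]
  have hγe : γ =ᶠ[𝓝 0] e.symm ∘ g := by
    filter_upwards [hg_mem] with t ht
    simp [γ, ht]
  have he : HasMFDerivAt 𝓘(ℝ, E) 𝓘(ℝ, E) e.symm (e x) (ContinuousLinearMap.id ℝ E) := by
    have h1 := ((contMDiffAt_extChartAt_symm x hz).mdifferentiableAt (by simp)).hasMFDerivAt
    have h2 := mfderivWithin_range_extChartAt_symm (I := 𝓘(ℝ, E)) (x := x)
    rw [ModelWithCorners.range_eq_univ, mfderivWithin_univ] at h2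
    rw [h2] at h1
    exact h1
  have hγd : HasMFDerivAt 𝓘(ℝ, ℝ) 𝓘(ℝ, E) (e.symm ∘ g) 0
      ((ContinuousLinearMap.id ℝ E).comp (ContinuousLinearMap.toSpanSingleton ℝ (v : E))) :=
    (hg0.symm ▸ he : HasMFDerivAt 𝓘(ℝ, E) 𝓘(ℝ, E) e.symm (g 0) _).comp 0
      hgd.hasFDerivAt.hasMFDerivAt
  have hγd' := hγd.congr_of_eventuallyEq hγe
  refine ⟨γ, fun t => ?_, hγd'.mdifferentiableAt, tangentBundle_mk_eq hγ0 ?_⟩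
  · by_cases ht : e.symm (g t) ∈ S <;> simp [γ, ht, hx]
  · rw [hγd'.mfderiv]
    exact one_smul ℝ (v : E)

end Tangent

/-! ### Row bases, minors and Gram determinants of real matrices. -/

section LinearAlgebra

/-- If the rows selected by `f` are linearly independent and as many as the rank, then every row
is a linear combination of them. -/
theorem exists_row_eq_sum_of_rank {m n κ : Type*} [Fintype m] [Fintype n] [Fintype κ]
    (M : Matrix m n ℝ) (f : κ → m) (hr : M.rank = Fintype.card κ)
    (hf : LinearIndependent ℝ fun k => M (f k)) (i : m) :
    ∃ u : κ → ℝ, ∀ j, M i j = ∑ k, u k * M (f k) j := by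
  have hle : Submodule.span ℝ (Set.range fun k => M (f k)) ≤ Submodule.span ℝ (Set.range M.row) :=
    Submodule.span_mono (by rintro _ ⟨k, rfl⟩; exact ⟨f k, rfl⟩)
  have heq := Submodule.eq_of_le_of_finrank_eq hle (by
    rw [finrank_span_eq_card hf, ← Matrix.rank_eq_finrank_span_row, hr])
  have hi : M i ∈ Submodule.span ℝ (Set.range fun k => M (f k)) := by
    rw [heq]
    exact Submodule.subset_span ⟨i, rfl⟩
  obtain ⟨u, hu⟩ := (Submodule.mem_span_range_iff_exists_fun ℝ).1 hi
  refine ⟨u, fun j => ?_⟩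
  rw [← hu]
  simp

theorem exists_linearIndependent_rows {m n : Type*} [Fintype m] [Fintype n]
    (M : Matrix m n ℝ) {r : ℕ} (hr : M.rank = r) :
    ∃ σ : Fin r ↪ m, LinearIndependent ℝ fun k => M (σ k) := by
  obtain ⟨κ, a, ha, hspan, hli⟩ := exists_linearIndependent' ℝ M.row
  have : Finite κ := Finite.of_injective a ha
  have := Fintype.ofFinite κ
  have hcard : Fintype.card κ = r := by
    rw [← hr, Matrix.rank_eq_finrank_span_row, ← hspan, finrank_span_eq_card hli]
  let e := (Fintype.equivFinOfCardEq hcard).symm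
  exact ⟨⟨a ∘ e, ha.comp e.injective⟩, hli.comp e e.injective⟩

/-- Linearly independent rows `σ` can be completed to a basis of the row space by rows of the second
block, if these together with the rows `σ` span the row space. -/
theorem exists_linearIndependent_rows_extension {m₁ m₂ n κ : Type*} [Fintype m₁] [Fintype m₂]
    [Fintype n] [Fintype κ] (M : Matrix (m₁ ⊕ m₂) n ℝ) (σ : κ ↪ m₁)
    (hσ : LinearIndependent ℝ fun k => M (Sum.inl (σ k)))
    (hspan : ∀ i, M (Sum.inl i) ∈
      Submodule.span ℝ (Set.range fun k => M (Sum.inl (σ k)))) :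
    ∃ (t : ℕ) (τ : Fin t ↪ m₂), Fintype.card κ + t = M.rank ∧
      LinearIndependent ℝ fun k : κ ⊕ Fin t => M (Sum.map σ τ k) := by
  classical
  have hs : LinearIndepOn ℝ M.row (Set.range fun k => (Sum.inl (σ k) : m₁ ⊕ m₂)) :=
    (linearIndepOn_range_iff (Sum.inl_injective.comp σ.injective) M.row).2 hσ
  -- Extending only inside the union of the selected rows and the second block ensures that every
  -- new row lies in the second block.
  obtain ⟨b, hbt, hsb, hb, hli⟩ := exists_linearIndepOn_extension hs
    (t := Set.range (fun k => (Sum.inl (σ k) : m₁ ⊕ m₂)) ∪ Set.range Sum.inr)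
    Set.subset_union_left
  let B : Finset m₂ := Finset.univ.filter fun j => Sum.inr j ∈ b
  let τ : Fin B.card ↪ m₂ := B.equivFin.symm.toEmbedding.trans (Function.Embedding.subtype _)
  have hτ : ∀ j, Sum.inr j ∈ b → ∃ l, τ l = j := fun j hj =>
    ⟨B.equivFin ⟨j, by simpa [B] using hj⟩, by simp [τ]⟩
  have hτb : ∀ l, Sum.inr (τ l) ∈ b := fun l => (Finset.mem_filter.1 (B.equivFin.symm l).2).2
  have hmem : ∀ k : κ ⊕ Fin B.card, Sum.map σ τ k ∈ b := by
    rintro (k | l)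
    · exact hsb ⟨k, rfl⟩
    · exact hτb l
  have hinj : Function.Injective (Sum.map σ τ) := Sum.map_injective.2 ⟨σ.injective, τ.injective⟩
  have hli' : LinearIndependent ℝ fun k : κ ⊕ Fin B.card => M (Sum.map σ τ k) :=
    hli.comp (fun k => (⟨Sum.map σ τ k, hmem k⟩ : b)) fun k l hkl => hinj (congrArg Subtype.val hkl)
  refine ⟨B.card, τ, ?_, hli'⟩
  have hbspan : Submodule.span ℝ (Set.range M.row)
      = Submodule.span ℝ (Set.range fun k : κ ⊕ Fin B.card => M (Sum.map σ τ k)) := by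
    have hb_sub : M.row '' b ⊆ Set.range fun k : κ ⊕ Fin B.card => M (Sum.map σ τ k) := by
      rintro _ ⟨i, hi, rfl⟩
      rcases hbt hi with ⟨k, rfl⟩ | ⟨j, rfl⟩
      · exact ⟨Sum.inl k, rfl⟩
      · obtain ⟨l, rfl⟩ := hτ j hi
        exact ⟨Sum.inr l, rfl⟩
    refine le_antisymm (Submodule.span_le.2 ?_) (Submodule.span_mono ?_)
    · rintro _ ⟨i | j, rfl⟩
      · refine Submodule.span_mono ?_ (hspan i)
        rintro _ ⟨k, rfl⟩
        exact ⟨Sum.inl k, rfl⟩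
      · exact Submodule.span_mono hb_sub (hb ⟨Sum.inr j, Or.inr ⟨j, rfl⟩, rfl⟩)
    · rintro _ ⟨k, rfl⟩
      exact ⟨_, rfl⟩
  rw [Matrix.rank_eq_finrank_span_row, hbspan, finrank_span_eq_card hli', Fintype.card_sum,
    Fintype.card_fin]

/-- In an antisymmetric matrix, the principal minor on a row basis does not vanish. -/
theorem det_ne_zero_of_antisymm {m κ : Type*} [Fintype m] [Fintype κ] [DecidableEq κ]
    (M : Matrix m m ℝ) (hM : ∀ i j, M i j = -M j i) (f : κ → m)
    (hf : LinearIndependent ℝ fun k => M (f k))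
    (hspan : ∀ i, ∃ u : κ → ℝ, ∀ j, M i j = ∑ k, u k * M (f k) j) :
    (M.submatrix f f).det ≠ 0 := by
  intro hdet
  obtain ⟨v, hv0, hv⟩ := Matrix.exists_vecMul_eq_zero_iff.2 hdet
  have hcol : ∀ k, ∑ l, v l * M (f l) (f k) = 0 := fun k => congrFun hv k
  -- By antisymmetry the selected columns span all columns, just as the selected rows span all rows.
  -- A left null vector of the minor thus annihilates every column, which is a relation between
  -- independent rows.
  have hall : ∀ j, ∑ l, v l * M (f l) j = 0 := fun j => by
    obtain ⟨u, hu⟩ := hspan j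
    have h1 : ∀ l, v l * M (f l) j = ∑ k, u k * (v l * M (f l) (f k)) := fun l => by
      rw [hM, hu, ← Finset.sum_neg_distrib, Finset.mul_sum]
      refine Finset.sum_congr rfl fun k _ => ?_
      rw [hM (f k) (f l)]
      ring
    simp only [h1]
    rw [Finset.sum_comm]
    simp only [← Finset.mul_sum, hcol, mul_zero, Finset.sum_const_zero]
  refine hv0 (funext (Fintype.linearIndependent_iff.1 hf v ?_))
  ext j
  simpa using hall j

/-- The Gram determinant of linearly independent rows does not vanish. -/
theorem det_mul_transpose_ne_zero {κ J : Type*} [Fintype κ] [DecidableEq κ] [Fintype J]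
    (R : Matrix κ J ℝ) (hR : LinearIndependent ℝ fun k => R k) :
    (R * R.transpose).det ≠ 0 := by
  intro hdet
  obtain ⟨v, hv0, hv⟩ := Matrix.exists_vecMul_eq_zero_iff.2 hdet
  -- Pairing the null vector of the Gram matrix with itself gives the squared length of vR.
  have h1 : Matrix.vecMul v R ⬝ᵥ Matrix.vecMul v R = 0 := by
    have h2 : Matrix.vecMul v (R * R.transpose) ⬝ᵥ v = 0 := by rw [hv, zero_dotProduct]
    rw [← Matrix.vecMul_vecMul, ← Matrix.dotProduct_mulVec, Matrix.mulVec_transpose] at h2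
    exact h2
  have h3 := dotProduct_self_eq_zero.1 h1
  refine hv0 (funext (Fintype.linearIndependent_iff.1 hR v ?_))
  ext j
  simpa [Matrix.vecMul, dotProduct] using congrFun h3 j

/-- A family that spans at least as much as a linearly independent one of the same cardinality is
linearly independent. -/
theorem linearIndependent_of_mem_span {V ι κ : Type*} [AddCommGroup V] [Module ℝ V]
    [Fintype ι] [Fintype κ] {v : ι → V} {w : κ → V} (hv : LinearIndependent ℝ v)
    (hcard : Fintype.card κ = Fintype.card ι)
    (h : ∀ i, v i ∈ Submodule.span ℝ (Set.range w)) : LinearIndependent ℝ w := by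
  rw [linearIndependent_iff_card_le_finrank_span, hcard, ← finrank_span_eq_card hv]
  have : FiniteDimensional ℝ (Submodule.span ℝ (Set.range w)) :=
    FiniteDimensional.span_of_finite ℝ (Set.finite_range w)
  exact Submodule.finrank_mono (Submodule.span_le.2 (by rintro _ ⟨i, rfl⟩; exact h i))

end LinearAlgebra

/-! ### Smooth solutions of linear systems that depend on a point. -/

section SmoothMatrices

variable {E : Type*} [NormedAddCommGroup E] [NormedSpace ℝ E]
  {P : Type*} [TopologicalSpace P] [ChartedSpace E P] {W : Set P}

theorem SmoothOn.finset_sum {ι : Type*} {s : Finset ι} {f : ι → P → ℝ}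
    (h : ∀ i ∈ s, SmoothOn E (f i) W) : SmoothOn E (fun x => ∑ i ∈ s, f i x) W :=
  contMDiffOn_finsetSum h

theorem SmoothOn.finset_prod {ι : Type*} {s : Finset ι} {f : ι → P → ℝ}
    (h : ∀ i ∈ s, SmoothOn E (f i) W) : SmoothOn E (fun x => ∏ i ∈ s, f i x) W :=
  contMDiffOn_finsetProd h

theorem SmoothOn.mul {f g : P → ℝ} (hf : SmoothOn E f W) (hg : SmoothOn E g W) :
    SmoothOn E (fun x => f x * g x) W :=
  ContMDiffOn.mul hf hg

theorem SmoothOn.add {f g : P → ℝ} (hf : SmoothOn E f W) (hg : SmoothOn E g W) :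
    SmoothOn E (fun x => f x + g x) W :=
  ContMDiffOn.add hf hg

theorem SmoothOn.neg {f : P → ℝ} (hf : SmoothOn E f W) : SmoothOn E (fun x => -f x) W :=
  ContMDiffOn.neg hf

theorem smoothOn_const (a : ℝ) : SmoothOn E (fun _ : P => a) W := contMDiffOn_const

theorem SmoothOn.det {κ : Type*} [Fintype κ] [DecidableEq κ] {M : P → Matrix κ κ ℝ}
    (h : ∀ i j, SmoothOn E (fun x => M x i j) W) : SmoothOn E (fun x => (M x).det) W := by
  simp only [Matrix.det_apply']
  exact SmoothOn.finset_sum fun σ _ =>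
    (smoothOn_const _).mul (SmoothOn.finset_prod fun i _ => h _ _)

/-- The adjugate replaces the inverse because it is polynomial in the entries, hence smooth even
where the determinant vanishes. -/
theorem SmoothOn.adjugate {κ : Type*} [Fintype κ] [DecidableEq κ] {M : P → Matrix κ κ ℝ}
    (h : ∀ i j, SmoothOn E (fun x => M x i j) W) (i j : κ) :
    SmoothOn E (fun x => (M x).adjugate i j) W := by
  simp only [Matrix.adjugate_apply]
  refine SmoothOn.det fun k l => ?_
  by_cases hk : k = j
  · subst hk
    simpa using smoothOn_const _
  · simpa [Matrix.updateRow_ne hk] using h k l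

/-- If on the closed subset `T` of `W`, cut out by `N = 0`, the row `A` is a combination of the
linearly independent rows `R k`, then the coefficients on `T` extend smoothly to `W`. -/
theorem exists_smoothOn_coefficients {κ J : Type*} [Fintype κ] [Fintype J]
    {T : Set P} {A : J → P → ℝ} {R : κ → J → P → ℝ} {N : P → ℝ}
    (hA : ∀ j, SmoothOn E (A j) W) (hR : ∀ k j, SmoothOn E (R k j) W) (hN : SmoothOn E N W)
    (hN0 : ∀ x ∈ T ∩ W, N x = 0) (hNpos : ∀ x ∈ W, x ∉ T → 0 < N x)
    (hind : ∀ x ∈ T ∩ W, LinearIndependent ℝ fun k j => R k j x)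
    (hspan : ∀ x ∈ T ∩ W, ∃ u : κ → ℝ, ∀ j, A j x = ∑ k, u k * R k j x) :
    ∃ c : κ → P → ℝ, (∀ k, SmoothOn E (c k) W) ∧
      ∀ x ∈ T ∩ W, ∀ j, A j x = ∑ k, c k x * R k j x := by
  classical
  let M : P → Matrix κ J ℝ := fun x => Matrix.of fun k j => R k j x
  let G : P → Matrix κ κ ℝ := fun x => M x * (M x).transpose
  have hG : ∀ i j, SmoothOn E (fun x => G x i j) W := fun i j => by
    simp only [G, M, Matrix.mul_apply, Matrix.transpose_apply, Matrix.of_apply]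
    exact SmoothOn.finset_sum fun l _ => (hR _ _).mul (hR _ _)
  have hdet : ∀ x ∈ T ∩ W, (G x).det ≠ 0 := fun x hx =>
    det_mul_transpose_ne_zero (M x) (hind x hx)
  have hden : ∀ x ∈ W, (G x).det * (G x).det + N x ≠ 0 := fun x hx => by
    by_cases hT : x ∈ T
    · rw [hN0 x ⟨hT, hx⟩, add_zero]
      exact mul_self_ne_zero.2 (hdet x ⟨hT, hx⟩)
    · exact (add_pos_of_nonneg_of_pos (mul_self_nonneg _) (hNpos x hx hT)).ne'
  -- On T the coefficients are A Rᵀ G⁻¹ with the Gram matrix G, and G⁻¹ is the adjugate divided by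
  -- det G. The factor det/(det² + N) equals 1/det where N = 0, and its denominator is also positive
  -- off T, where the rows may become dependent.
  refine ⟨fun k x => (∑ l, (∑ j, A j x * R l j x) * (G x).adjugate l k)
    * ((G x).det * ((G x).det * (G x).det + N x)⁻¹), fun k => ?_, fun x hx j => ?_⟩
  · refine SmoothOn.mul (SmoothOn.finset_sum fun l _ => SmoothOn.mul
      (SmoothOn.finset_sum fun j _ => (hA j).mul (hR l j)) (SmoothOn.adjugate hG l k))
      (SmoothOn.mul (SmoothOn.det hG) ?_)
    exact ContMDiffOn.inv₀ (((SmoothOn.det hG).mul (SmoothOn.det hG)).add hN) hden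
  · obtain ⟨u, hu⟩ := hspan x hx
    have h1 : (fun l => ∑ j, A j x * R l j x) = Matrix.vecMul u (G x) := by
      have h2 : (fun j => A j x) = Matrix.vecMul u (M x) := funext hu
      have h3 : (fun l => ∑ j, A j x * R l j x)
          = Matrix.vecMul (fun j => A j x) (M x).transpose := rfl
      rw [h3, h2, Matrix.vecMul_vecMul]
    have h4 : ∀ k, ∑ l, (∑ j, A j x * R l j x) * (G x).adjugate l k = (G x).det * u k := by
      intro k
      have h5 : (fun k => ∑ l, (∑ j, A j x * R l j x) * (G x).adjugate l k)
          = Matrix.vecMul (fun l => ∑ j, A j x * R l j x) (G x).adjugate := rfl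
      have h6 := congrFun h5 k
      rw [h1, Matrix.vecMul_vecMul, Matrix.mul_adjugate, Matrix.vecMul_smul,
        Matrix.vecMul_one] at h6
      exact h6
    rw [hu j]
    refine Finset.sum_congr rfl fun k _ => ?_
    beta_reduce
    rw [h4, hN0 x hx, add_zero]
    have hd := hdet x hx
    field_simp

end SmoothMatrices

/-! ### Algebra of Poisson and Dirac brackets. -/

section Brackets

variable {E : Type*} [NormedAddCommGroup E] [NormedSpace ℝ E] [FiniteDimensional ℝ E]
  {P : Type*} [TopologicalSpace P] [ChartedSpace E P] (Ω : SymplecticForm E P)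

omit [FiniteDimensional ℝ E] in
theorem SymplecticForm.antisymm (x : P) (v w : TangentSpace 𝓘(ℝ, E) x) :
    Ω.form x v w = -Ω.form x w v := by
  have h := Ω.alternating x (v + w)
  simp only [map_add, add_apply, Ω.alternating] at h
  linarith

theorem poisson_antisymm (f g : P → ℝ) (x : P) : poisson Ω f g x = -poisson Ω g f x :=
  Ω.antisymm x _ _

theorem hamField_eq_iff {f : P → ℝ} {x : P} {v : TangentSpace 𝓘(ℝ, E) x} :
    hamField Ω f x = v ↔ mvfderiv 𝓘(ℝ, E) f x = Ω.form x v := by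
  rw [← form_hamField Ω f x]
  exact ((Ω.form_bijective x).1.eq_iff).symm

/-- Here and in the analogues for brackets and Dirac fields, only an identity of differentials at
one point is assumed. This covers both constant coefficients and variable coefficients of functions
that vanish at the point. -/
theorem hamField_eq_add_sum {ι : Type*} [Fintype ι] {f h : P → ℝ} {g : ι → P → ℝ} {a : ι → ℝ}
    {x : P} (hf : mvfderiv 𝓘(ℝ, E) f x
      = mvfderiv 𝓘(ℝ, E) h x + ∑ i, a i • mvfderiv 𝓘(ℝ, E) (g i) x) :
    hamField Ω f x = hamField Ω h x + ∑ i, a i • hamField Ω (g i) x := by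
  rw [hamField_eq_iff, hf]
  simp only [map_add, map_sum, map_smul, form_hamField]

theorem poisson_left_eq_add_sum {ι : Type*} [Fintype ι] {f h : P → ℝ} {g : ι → P → ℝ}
    {a : ι → ℝ} {x : P} (hf : mvfderiv 𝓘(ℝ, E) f x
      = mvfderiv 𝓘(ℝ, E) h x + ∑ i, a i • mvfderiv 𝓘(ℝ, E) (g i) x) (k : P → ℝ) :
    poisson Ω f k x = poisson Ω h k x + ∑ i, a i * poisson Ω (g i) k x := by
  simp only [← mvfderiv_hamField, hf, add_apply, sum_apply,
    smul_apply, smul_eq_mul]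

theorem poisson_right_eq_add_sum {ι : Type*} [Fintype ι] {f h : P → ℝ} {g : ι → P → ℝ}
    {a : ι → ℝ} {x : P} (hf : mvfderiv 𝓘(ℝ, E) f x
      = mvfderiv 𝓘(ℝ, E) h x + ∑ i, a i • mvfderiv 𝓘(ℝ, E) (g i) x) (k : P → ℝ) :
    poisson Ω k f x = poisson Ω k h x + ∑ i, a i * poisson Ω k (g i) x := by
  rw [poisson_antisymm, poisson_left_eq_add_sum Ω hf, poisson_antisymm Ω k h]
  simp only [poisson_antisymm Ω k (g _), mul_neg, Finset.sum_neg_distrib]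
  ring

theorem diracField_eq_add_sum {ι κ : Type*} [Fintype ι] [Fintype κ] [DecidableEq κ]
    (χ : κ → P → ℝ) {f h : P → ℝ} {g : ι → P → ℝ} {a : ι → ℝ} {x : P}
    (hf : mvfderiv 𝓘(ℝ, E) f x
      = mvfderiv 𝓘(ℝ, E) h x + ∑ i, a i • mvfderiv 𝓘(ℝ, E) (g i) x) :
    diracField Ω χ f x = diracField Ω χ h x + ∑ i, a i • diracField Ω χ (g i) x := by
  simp only [diracField, hamField_eq_add_sum Ω hf, poisson_right_eq_add_sum Ω hf, smul_sub,
    Finset.sum_sub_distrib, mul_add, add_smul, Finset.sum_add_distrib]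
  have h1 : ∀ k l, ((bracketMatrix Ω χ χ x)⁻¹ k l * ∑ i, a i * poisson Ω (χ l) (g i) x)
      • hamField Ω (χ k) x = ∑ i, a i • ((bracketMatrix Ω χ χ x)⁻¹ k l
        * poisson Ω (χ l) (g i) x) • hamField Ω (χ k) x := fun k l => by
    simp only [Finset.mul_sum, Finset.sum_smul, smul_smul]
    refine Finset.sum_congr rfl fun i _ => ?_
    congr 1
    ring
  simp only [h1, Finset.smul_sum]
  have h2 : (∑ k, ∑ l, ∑ i, a i • ((bracketMatrix Ω χ χ x)⁻¹ k l
        * poisson Ω (χ l) (g i) x) • hamField Ω (χ k) x)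
      = ∑ i, ∑ k, ∑ l, a i • ((bracketMatrix Ω χ χ x)⁻¹ k l
        * poisson Ω (χ l) (g i) x) • hamField Ω (χ k) x := by
    rw [Finset.sum_comm (s := (Finset.univ : Finset ι))]
    refine Finset.sum_congr rfl fun k _ => ?_
    rw [Finset.sum_comm]
  rw [h2]
  abel

theorem diracField_eq_hamField {κ : Type*} [Fintype κ] [DecidableEq κ] {χ : κ → P → ℝ}
    {f : P → ℝ} {x : P} (h : ∀ k, poisson Ω (χ k) f x = 0) :
    diracField Ω χ f x = hamField Ω f x := by
  simp [diracField, h]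

/-- The second class constraints are Casimir functions of the Dirac bracket. -/
theorem diracField_second_class {κ : Type*} [Fintype κ] [DecidableEq κ] {χ : κ → P → ℝ}
    {x : P} (h : (bracketMatrix Ω χ χ x).det ≠ 0) (k : κ) : diracField Ω χ (χ k) x = 0 := by
  have h1 : ∀ i, ∑ j, (bracketMatrix Ω χ χ x)⁻¹ i j * poisson Ω (χ j) (χ k) x
      = (1 : Matrix κ κ ℝ) i k := fun i => by
    rw [← Matrix.nonsing_inv_mul _ (isUnit_iff_ne_zero.2 h), Matrix.mul_apply]
    rfl
  simp only [diracField, ← Finset.sum_smul, h1, Matrix.one_apply, ite_smul, one_smul, zero_smul]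
  simp

theorem diracBracket_second_class {κ : Type*} [Fintype κ] [DecidableEq κ] {χ : κ → P → ℝ}
    {x : P} (h : (bracketMatrix Ω χ χ x).det ≠ 0) (k : κ) (f : P → ℝ) :
    diracBracket Ω χ (χ k) f x = 0 := by
  have h1 : ∀ j, ∑ i, poisson Ω (χ k) (χ i) x * (bracketMatrix Ω χ χ x)⁻¹ i j
      = (1 : Matrix κ κ ℝ) k j := fun j => by
    rw [← Matrix.mul_nonsing_inv _ (isUnit_iff_ne_zero.2 h), Matrix.mul_apply]
    rfl
  rw [diracBracket, Finset.sum_comm]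
  simp only [← Finset.sum_mul, h1, Matrix.one_apply, ite_mul, one_mul, zero_mul]
  simp

/-- Evaluating a relation between the differentials on the fields of the g j yields a relation
between the rows of an invertible matrix. The hypothesis is an open condition, which is how
independence on S spreads to a neighborhood. -/
theorem linearIndependent_mvfderiv_of_det_ne_zero {ι : Type*} [Fintype ι] [DecidableEq ι]
    {f g : ι → P → ℝ} {x : P} (h : (bracketMatrix Ω f g x).det ≠ 0) :
    LinearIndependent ℝ fun i => mvfderiv 𝓘(ℝ, E) (f i) x := by
  refine Fintype.linearIndependent_iff.2 fun a ha => ?_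
  have hr := Matrix.linearIndependent_rows_iff_isUnit.2
    ((Matrix.isUnit_iff_isUnit_det _).2 (isUnit_iff_ne_zero.2 h))
  refine Fintype.linearIndependent_iff.1 hr a ?_
  ext j
  have h1 := congrArg (fun ξ => ξ (hamField Ω (g j) x)) ha
  simpa [mvfderiv_hamField, bracketMatrix] using h1

variable [IsManifold 𝓘(ℝ, E) ∞ P]

theorem SmoothOn.bracketMatrix {ι κ : Type*} {f : ι → P → ℝ} {g : κ → P → ℝ} {W : Set P}
    (hW : IsOpen W) (hf : ∀ i, SmoothOn E (f i) W) (hg : ∀ k, SmoothOn E (g k) W) (i : ι) (k : κ) :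
    SmoothOn E (fun x => bracketMatrix Ω f g x i k) W :=
  SmoothOn.poisson Ω hW (hf i) (hg k)

theorem isOpen_setOf_bracket_det_ne_zero {ι : Type*} [Fintype ι] [DecidableEq ι]
    {f g : ι → P → ℝ} {W : Set P} (hW : IsOpen W) (hf : ∀ i, SmoothOn E (f i) W)
    (hg : ∀ i, SmoothOn E (g i) W) : IsOpen (W ∩ {x | (bracketMatrix Ω f g x).det ≠ 0}) :=
  (SmoothOn.det (SmoothOn.bracketMatrix Ω hW hf hg)).continuousOn.isOpen_inter_preimage hW
    isOpen_ne

/-- Functions with independent differentials at a point have conjugate functions near it. -/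
theorem exists_conjugate_functions {ι : Type*} [Fintype ι] [DecidableEq ι] {f : ι → P → ℝ}
    {W : Set P} (hW : IsOpen W) (hf : ∀ i, SmoothOn E (f i) W) {x₀ : P} (hx₀ : x₀ ∈ W)
    (hind : LinearIndependent ℝ fun i => mvfderiv 𝓘(ℝ, E) (f i) x₀) :
    ∃ W' : Set P, IsOpen W' ∧ x₀ ∈ W' ∧ W' ⊆ W ∧ ∃ g : ι → P → ℝ, (∀ i, SmoothOn E (g i) W') ∧
      ∀ x ∈ W', (bracketMatrix Ω f g x).det ≠ 0 := by
  have hind' : LinearIndependent ℝ fun i => (mvfderiv 𝓘(ℝ, E) (f i) x₀ : E →L[ℝ] ℝ) := hind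
  have hsurj := surjective_pi_of_linearIndependent (V := E)
    (ξ := fun i => (mvfderiv 𝓘(ℝ, E) (f i) x₀ : E →L[ℝ] ℝ).toLinearMap)
    (hind'.map' (ContinuousLinearMap.coeLM ℝ)
      (LinearMap.ker_eq_bot.2 ContinuousLinearMap.coe_injective))
  -- The vectors v are dual to the differentials at x₀. Choosing g with differentials Ω(v i, ·)
  -- makes v i the Hamiltonian vector of g i, so the bracket matrix is the identity at x₀.
  choose v hv using fun i : ι => hsurj (Pi.single i 1)
  obtain ⟨W₁, hW₁, hx₁, hF⟩ := exists_smoothOn_mvfderiv_eq (E := E) x₀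
  choose g hg hgv using fun i => hF (Ω.form x₀ (v i))
  have hone : bracketMatrix Ω f g x₀ = 1 := by
    ext i j
    have h1 : hamField Ω (g j) x₀ = v j := (hamField_eq_iff Ω).2 (hgv j)
    have h2 : mvfderiv 𝓘(ℝ, E) (f i) x₀ (v j) = (Pi.single j 1 : ι → ℝ) i := congrFun (hv j) i
    rw [bracketMatrix, Matrix.of_apply, ← mvfderiv_hamField, h1, h2, Matrix.one_apply,
      Pi.single_apply]
  refine ⟨_, isOpen_setOf_bracket_det_ne_zero Ω (f := f) (g := g) (hW.inter hW₁)
    (fun i => (hf i).mono Set.inter_subset_left) (fun i => (hg i).mono Set.inter_subset_right),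
    ⟨⟨hx₀, hx₁⟩, ?_⟩, fun x hx => hx.1.1, g, fun i => (hg i).mono fun x hx => hx.1.2,
    fun x hx => hx.2⟩
  simp [hone]

end Brackets

/-! ### Splitting indices into selected and unselected ones. -/

section IndexSplitting

theorem bijective_complement_sum {r p : ℕ} (σ : Fin r ↪ Fin p) :
    Function.Bijective (Sum.elim Subtype.val σ : {i // i ∉ Set.range σ} ⊕ Fin r → Fin p) := by
  constructor
  · rintro (i | k) (j | l) h
    · exact congrArg Sum.inl (Subtype.ext h)
    · exact absurd ⟨l, h.symm⟩ i.2
    · exact absurd ⟨k, h⟩ j.2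
    · exact congrArg Sum.inr (σ.injective h)
  · intro i
    by_cases hi : i ∈ Set.range σ
    · obtain ⟨k, rfl⟩ := hi
      exact ⟨Sum.inr k, rfl⟩
    · exact ⟨Sum.inl ⟨i, hi⟩, rfl⟩

/-- The indices not chosen by `σ`, followed by the chosen ones. -/
noncomputable def complementSumEquiv {r p : ℕ} (σ : Fin r ↪ Fin p) :
    {i // i ∉ Set.range σ} ⊕ Fin r ≃ Fin p :=
  Equiv.ofBijective _ (bijective_complement_sum σ)

theorem complementSumEquiv_symm_val {r p : ℕ} (σ : Fin r ↪ Fin p) (i : {i // i ∉ Set.range σ}) :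
    (complementSumEquiv σ).symm i.1 = Sum.inl i :=
  (complementSumEquiv σ).symm_apply_eq.2 rfl

theorem complementSumEquiv_symm_apply {r p : ℕ} (σ : Fin r ↪ Fin p) (k : Fin r) :
    (complementSumEquiv σ).symm (σ k) = Sum.inr k :=
  (complementSumEquiv σ).symm_apply_eq.2 rfl

theorem sum_eq_sum_complement_add {r p : ℕ} (σ : Fin r ↪ Fin p) {M : Type*} [AddCommMonoid M]
    (f : Fin p → M) :
    ∑ i, f i = ∑ i : {i // i ∉ Set.range σ}, f i.1 + ∑ k, f (σ k) := by
  rw [← (complementSumEquiv σ).sum_comp f, Fintype.sum_sum_type]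
  rfl

theorem forall_complement {r p : ℕ} (σ : Fin r ↪ Fin p) {Q : Fin p → Prop}
    (h1 : ∀ i : {i // i ∉ Set.range σ}, Q i.1) (h2 : ∀ k, Q (σ k)) (i : Fin p) : Q i := by
  obtain ⟨j | k, rfl⟩ := (bijective_complement_sum σ).2 i
  exacts [h1 j, h2 k]

theorem primaryFirst_primarySecond_eq_zero_iff {P : Type*} {p q r : ℕ}
    {φ : Fin p ⊕ Fin q → P → ℝ} {σ : Fin r ↪ Fin p}
    {α : {i // i ∉ Set.range σ} → Fin r → P → ℝ} {x : P} :
    (∀ k, (Sum.elim (primaryFirst φ σ α) (primarySecond φ σ) k) x = 0)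
      ↔ ∀ i, φ (Sum.inl i) x = 0 := by
  constructor
  · intro h
    have h2 : ∀ k, φ (Sum.inl (σ k)) x = 0 := fun k => h (Sum.inr k)
    refine forall_complement σ (fun i => ?_) h2
    have h1 : φ (Sum.inl i) x + ∑ k, α i k x * φ (Sum.inl (σ k)) x = 0 := h (Sum.inl i)
    simpa [h2] using h1
  · rintro h (i | k)
    · simp [primaryFirst, h]
    · exact h _

end IndexSplitting

/-! ### First class constraints in terms of brackets. -/

section FirstClass

variable {E : Type*} [NormedAddCommGroup E] [NormedSpace ℝ E]
  {P : Type*} [TopologicalSpace P] [ChartedSpace E P]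

theorem RegularlyDefines.mem_iff {ι : Type*} {φ : ι → P → ℝ} {U S : Set P}
    (h : RegularlyDefines E φ U S) {x : P} : x ∈ S ↔ x ∈ U ∧ ∀ i, φ i x = 0 := by
  conv_lhs => rw [h.zeroSet]
  rfl

theorem RegularlyDefines.subset {ι : Type*} {φ : ι → P → ℝ} {U S : Set P}
    (h : RegularlyDefines E φ U S) : S ⊆ U := fun _ hx => (h.mem_iff.1 hx).1

variable [FiniteDimensional ℝ E] (Ω : SymplecticForm E P)

variable {Ω} in
theorem IsFirstClassConstraint.mono {S W W' : Set P} {f : P → ℝ}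
    (h : IsFirstClassConstraint Ω S W f) (hW : W' ⊆ W) : IsFirstClassConstraint Ω S W' f :=
  ⟨h.smooth.mono hW, fun x hx => h.vanishes x ⟨hx.1, hW hx.2⟩,
    fun x hx => h.tangent x ⟨hx.1, hW hx.2⟩⟩

variable {Ω} in
/-- A first class constraint has vanishing bracket on `S` with every constraint. -/
theorem IsFirstClassConstraint.poisson_eq_zero {S W : Set P} {f g : P → ℝ}
    (h : IsFirstClassConstraint Ω S W f) (hW : IsOpen W) (hg : SmoothOn E g W)
    (hg0 : ∀ x ∈ S ∩ W, g x = 0) {x : P} (hx : x ∈ S ∩ W) : poisson Ω f g x = 0 := by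
  rw [poisson_antisymm, neg_eq_zero, ← mvfderiv_hamField]
  refine mvfderiv_eq_zero_of_mem_tangentTo (SmoothOn.mdifferentiableAt hg hW hx.2) ?_
    (h.tangent x hx)
  filter_upwards [hW.mem_nhds hx.2] with y hy hyS
  exact hg0 y ⟨hyS, hy⟩

variable [IsManifold 𝓘(ℝ, E) ∞ P]

theorem RegularlyDefines.hamField_mem_tangentTo_iff {ι : Type*} [Fintype ι] {φ : ι → P → ℝ}
    {U S : Set P} (h : RegularlyDefines E φ U S) {x : P} (hx : x ∈ S) {f : P → ℝ} :
    hamField Ω f x ∈ tangentTo E S x ↔ ∀ j, poisson Ω f (φ j) x = 0 := by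
  rw [h.mem_tangentTo_iff hx]
  refine forall_congr' fun j => ?_
  rw [mvfderiv_hamField, poisson_antisymm, neg_eq_zero]

omit [FiniteDimensional ℝ E] [IsManifold 𝓘(ℝ, E) ∞ P] in
/-- A covector vanishing on the common kernel of others is a linear combination of them. -/
theorem exists_eq_sum_of_forall_eq_zero {ι : Type*} [Fintype ι] {x : P}
    {ξ : ι → TangentSpace 𝓘(ℝ, E) x →L[ℝ] ℝ} {η : TangentSpace 𝓘(ℝ, E) x →L[ℝ] ℝ}
    (h : ∀ v, (∀ i, ξ i v = 0) → η v = 0) : ∃ a : ι → ℝ, η = ∑ i, a i • ξ i := by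
  have h1 : η.toLinearMap ∈ Submodule.span ℝ (Set.range fun i => (ξ i).toLinearMap) := by
    refine mem_span_of_iInf_ker_le_ker fun v hv => ?_
    simp only [Submodule.mem_iInf] at hv
    exact h v hv
  obtain ⟨a, ha⟩ := (Submodule.mem_span_range_iff_exists_fun ℝ).1 h1
  refine ⟨a, ?_⟩
  ext v
  have h2 := congrArg (fun L : TangentSpace 𝓘(ℝ, E) x →ₗ[ℝ] ℝ => L v) ha
  simpa using h2.symm

/-- Linear independence of rows of brackets is an open condition. -/
theorem isOpen_setOf_rows_linearIndependent {κ J : Type*} [Fintype κ] [Fintype J]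
    {f : κ → P → ℝ} {g : J → P → ℝ} {W : Set P} (hW : IsOpen W)
    (hf : ∀ i, SmoothOn E (f i) W) (hg : ∀ i, SmoothOn E (g i) W) :
    IsOpen (W ∩ {x | LinearIndependent ℝ fun k j => bracketMatrix Ω f g x k j}) := by
  have hcont : ContinuousOn (fun x k j => bracketMatrix Ω f g x k j) W :=
    continuousOn_pi.2 fun k => continuousOn_pi.2 fun j =>
      (SmoothOn.bracketMatrix Ω hW hf hg k j).continuousOn
  exact hcont.isOpen_inter_preimage hW (isOpen_setOfPred_linearIndependent (𝕜 := ℝ))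

end FirstClass

/-! ### The primary constraints ψ' and χ'. -/

section Constraints

variable {E : Type*} [NormedAddCommGroup E] [NormedSpace ℝ E] [FiniteDimensional ℝ E]
  {P : Type*} [TopologicalSpace P] [ChartedSpace E P]
  {Ω : SymplecticForm E P} {p q r t : ℕ} {φ : Fin p ⊕ Fin q → P → ℝ} {U V W S' S : Set P}
  {σ : Fin r ↪ Fin p} {α : {i // i ∉ Set.range σ} → Fin r → P → ℝ}

omit [FiniteDimensional ℝ E] in
theorem final_subset_primary (hS' : RegularlyDefines E (fun i => φ (Sum.inl i)) U S')
    (hS : RegularlyDefines E φ U S) : S ⊆ S' := fun _ hx =>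
  hS'.mem_iff.2 ⟨(hS.mem_iff.1 hx).1, fun i => (hS.mem_iff.1 hx).2 (Sum.inl i)⟩

omit [FiniteDimensional ℝ E] in
theorem smoothOn_primaryFirst (hφ : ∀ i, SmoothOn E (φ i) W)
    (hα : ∀ i k, SmoothOn E (α i k) W) (i : {i // i ∉ Set.range σ}) :
    SmoothOn E (primaryFirst φ σ α i) W :=
  SmoothOn.add (hφ _) (SmoothOn.finset_sum fun k _ => (hα i k).mul (hφ _))

omit [FiniteDimensional ℝ E] in
-- The derivatives of the coefficients drop out because they multiply functions that vanish at x.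
theorem mvfderiv_primaryFirst (hW : IsOpen W) (hφ : ∀ i, SmoothOn E (φ i) W)
    (hα : ∀ i k, SmoothOn E (α i k) W) {x : P} (hx : x ∈ W) (h0 : ∀ i, φ (Sum.inl i) x = 0)
    (i : {i // i ∉ Set.range σ}) :
    mvfderiv 𝓘(ℝ, E) (primaryFirst φ σ α i) x = mvfderiv 𝓘(ℝ, E) (φ (Sum.inl i.1)) x
      + ∑ k, α i k x • mvfderiv 𝓘(ℝ, E) (primarySecond φ σ k) x :=
  mvfderiv_add_sum_mul_of_eq_zero (SmoothOn.mdifferentiableAt (hφ _) hW hx)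
    (fun k => SmoothOn.mdifferentiableAt (hα i k) hW hx)
    (fun _ => SmoothOn.mdifferentiableAt (hφ _) hW hx) fun _ => h0 _

omit [FiniteDimensional ℝ E] in
theorem primary_mem_span (hW : IsOpen W) (hφ : ∀ i, SmoothOn E (φ i) W)
    (hα : ∀ i k, SmoothOn E (α i k) W) {x : P} (hx : x ∈ W) (h0 : ∀ i, φ (Sum.inl i) x = 0)
    (i : Fin p) : mvfderiv 𝓘(ℝ, E) (φ (Sum.inl i)) x ∈ Submodule.span ℝ (Set.range fun k =>
      mvfderiv 𝓘(ℝ, E) (Sum.elim (primaryFirst φ σ α) (primarySecond φ σ) k) x) := by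
  revert i
  refine forall_complement σ (fun i => ?_) (fun k => ?_)
  · have h1 := mvfderiv_primaryFirst hW hφ hα hx h0 i
    rw [← sub_eq_iff_eq_add] at h1
    rw [← h1]
    refine Submodule.sub_mem _ (Submodule.subset_span ⟨Sum.inl i, rfl⟩)
      (Submodule.sum_mem _ fun k _ => Submodule.smul_mem _ _
        (Submodule.subset_span ⟨Sum.inr k, rfl⟩))
  · exact Submodule.subset_span ⟨Sum.inr k, rfl⟩

omit [FiniteDimensional ℝ E] in
-- The passage from φ to (ψ', χ') is unipotent, hence invertible for any smooth α. Invertibility on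
-- differentials holds where the primary φ vanish, and this is enough.
theorem regularlyDefines_primary (hS' : RegularlyDefines E (fun i => φ (Sum.inl i)) U S')
    (hφ : ∀ i, SmoothOn E (φ i) U) (hW : IsOpen W) (hWU : W ⊆ U)
    (hα : ∀ i k, SmoothOn E (α i k) W) :
    RegularlyDefines E (Sum.elim (primaryFirst φ σ α) (primarySecond φ σ)) W (S' ∩ W) := by
  have hφW := fun i => (hφ i).mono hWU
  refine ⟨hW, ?_, ?_, ?_⟩
  · rintro (i | k)
    · exact smoothOn_primaryFirst hφW hα i
    · exact hφW _
  · ext x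
    rw [Set.mem_inter_iff, hS'.mem_iff, Set.mem_ofPred_eq, primaryFirst_primarySecond_eq_zero_iff]
    exact ⟨fun h => ⟨h.2, h.1.2⟩, fun h => ⟨⟨hWU h.1, h.2⟩, h.1⟩⟩
  · intro x hx
    refine linearIndependent_of_mem_span (hS'.independent x hx.1)
      (Fintype.card_congr (complementSumEquiv σ))
      (primary_mem_span hW hφW hα hx.2 (hS'.mem_iff.1 hx.1).2)

variable [IsManifold 𝓘(ℝ, E) ∞ P]

theorem exists_primary_second_class (hS : RegularlyDefines E φ U S) {x₀ : P} (hx₀ : x₀ ∈ S)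
    (hrank : (bracketMatrix Ω (fun i => φ (Sum.inl i)) φ x₀).rank = r) :
    ∃ (σ : Fin r ↪ Fin p) (V : Set P), IsOpen V ∧ x₀ ∈ V ∧ V ⊆ U ∧
      ∀ x ∈ S ∩ V, LinearIndependent ℝ
        (fun k j => bracketMatrix Ω (primarySecond φ σ) φ x k j) := by
  obtain ⟨σ, hσ⟩ := exists_linearIndependent_rows _ hrank
  exact ⟨σ, _, isOpen_setOf_rows_linearIndependent Ω (f := primarySecond φ σ) (g := φ) hS.isOpen
    (fun k => hS.smooth _) hS.smooth, ⟨hS.subset hx₀, hσ⟩, Set.inter_subset_left,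
    fun x hx => hx.2.2⟩

omit [FiniteDimensional ℝ E] [IsManifold 𝓘(ℝ, E) ∞ P] in
/-- The final constraint submanifold is the zero set of a nonnegative function. -/
theorem sum_sq_constraints (hS : RegularlyDefines E φ U S) (hWU : W ⊆ U) :
    SmoothOn E (fun x => ∑ i, φ i x * φ i x) W ∧ (∀ x ∈ S ∩ W, ∑ i, φ i x * φ i x = 0) ∧
      ∀ x ∈ W, x ∉ S → 0 < ∑ i, φ i x * φ i x := by
  refine ⟨SmoothOn.finset_sum fun i _ => ((hS.smooth i).mono hWU).mul ((hS.smooth i).mono hWU),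
    fun x hx => ?_, fun x hx hxS => ?_⟩
  · simp [(hS.mem_iff.1 hx.1).2]
  · refine (Finset.sum_nonneg fun i _ => mul_self_nonneg _).lt_of_ne' fun h0 => hxS ?_
    refine hS.mem_iff.2 ⟨hWU hx, fun i => ?_⟩
    exact mul_self_eq_zero.1
      ((Finset.sum_eq_zero_iff_of_nonneg fun i _ => mul_self_nonneg _).1 h0 i (Finset.mem_univ i))

/-- On S the rank condition writes each unselected row as a combination of the selected ones; α is
minus the coefficients, extended smoothly from S ∩ V to V. With this α all brackets of ψ' with the
constraints vanish on S. -/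
theorem exists_primaryFirst (hS' : RegularlyDefines E (fun i => φ (Sum.inl i)) U S')
    (hS : RegularlyDefines E φ U S)
    (hrank : ∀ x ∈ S, (bracketMatrix Ω (fun i => φ (Sum.inl i)) φ x).rank = r)
    (hV : IsOpen V) (hVU : V ⊆ U)
    (hσ : ∀ x ∈ S ∩ V, LinearIndependent ℝ
      (fun k j => bracketMatrix Ω (primarySecond φ σ) φ x k j)) :
    ∃ α : {i // i ∉ Set.range σ} → Fin r → P → ℝ, (∀ i k, SmoothOn E (α i k) V) ∧
      (∀ i, IsFirstClassConstraint Ω S V (primaryFirst φ σ α i)) ∧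
      RegularlyDefines E (Sum.elim (primaryFirst φ σ α) (primarySecond φ σ)) V (S' ∩ V) := by
  have hφ := fun i => (hS.smooth i).mono hVU
  obtain ⟨hN, hN0, hNpos⟩ := sum_sq_constraints hS hVU
  have hc := fun i : {i // i ∉ Set.range σ} => exists_smoothOn_coefficients (T := S)
    (A := fun j => poisson Ω (φ (Sum.inl i.1)) (φ j))
    (R := fun k j => poisson Ω (primarySecond φ σ k) (φ j))
    (fun j => SmoothOn.poisson Ω hV (hφ _) (hφ _)) (fun k j => SmoothOn.poisson Ω hV (hφ _) (hφ _))
    hN hN0 hNpos hσ fun x hx => exists_row_eq_sum_of_rank _ σ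
      ((hrank x hx.1).trans (Fintype.card_fin r).symm) (hσ x hx) i.1
  choose c hcs hc using hc
  have hα : ∀ i k, SmoothOn E (fun x => -c i k x) V := fun i k => (hcs i k).neg
  refine ⟨fun i k x => -c i k x, hα, fun i => ⟨smoothOn_primaryFirst hφ hα i, ?_, ?_⟩,
    regularlyDefines_primary hS' hS.smooth hV hVU hα⟩
  · intro x hx
    simp [primaryFirst, (hS.mem_iff.1 hx.1).2]
  · intro x hx
    refine (hS.hamField_mem_tangentTo_iff Ω hx.1).2 fun j => ?_
    rw [poisson_left_eq_add_sum Ω (mvfderiv_primaryFirst hV hφ hα hx.2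
      (fun i => (hS.mem_iff.1 hx.1).2 _) i), hc i x hx j]
    simp

end Constraints

/-! ### The secondary constraints ψ'' and χ''. -/

section SecondaryConstraints

variable {P : Type*} {p q r t : ℕ} {φ : Fin p ⊕ Fin q → P → ℝ} {σ : Fin r ↪ Fin p}
  {τ : Fin t ↪ Fin q} {α : {i // i ∉ Set.range σ} → Fin r → P → ℝ}
  {β : {j // j ∉ Set.range τ} → Fin r → P → ℝ} {γ : {j // j ∉ Set.range τ} → Fin t → P → ℝ}

theorem second_eq_comp_map :
    Sum.elim (primarySecond φ σ) (secondarySecond φ τ) = fun k => φ (Sum.map σ τ k) := by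
  funext k
  cases k <;> rfl

theorem secondaryFirst_eq (j : {j // j ∉ Set.range τ}) :
    secondaryFirst φ σ τ β γ j = fun x => φ (Sum.inr j.1) x
      + ∑ k, Sum.elim (β j) (γ j) k x * φ (Sum.map σ τ k) x := by
  funext x
  simp only [secondaryFirst, Fintype.sum_sum_type, Sum.elim_inl, Sum.elim_inr, Sum.map_inl,
    Sum.map_inr, add_assoc]

theorem first_second_eq_zero_iff {x : P} :
    (∀ k, (Sum.elim (Sum.elim (primaryFirst φ σ α) (secondaryFirst φ σ τ β γ))
      (Sum.elim (primarySecond φ σ) (secondarySecond φ τ)) k) x = 0) ↔ ∀ i, φ i x = 0 := by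
  constructor
  · intro h
    have h2 : ∀ k, φ (Sum.map σ τ k) x = 0 := fun k => by
      have := h (Sum.inr k)
      rwa [Sum.elim_inr, second_eq_comp_map] at this
    have h1 : ∀ i, φ (Sum.inl i) x = 0 := primaryFirst_primarySecond_eq_zero_iff.1 (by
      rintro (i | k)
      exacts [h (Sum.inl (Sum.inl i)), h (Sum.inr (Sum.inl k))])
    rintro (i | j)
    · exact h1 i
    · revert j
      refine forall_complement τ (fun j => ?_) (fun l => h2 (Sum.inr l))
      have h3 : secondaryFirst φ σ τ β γ j x = 0 := h (Sum.inl (Sum.inr j))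
      rw [secondaryFirst_eq] at h3
      simpa [h2] using h3
  · rintro h ((i | j) | (k | l))
    · exact primaryFirst_primarySecond_eq_zero_iff.2 (fun i => h _) (Sum.inl i)
    · rw [Sum.elim_inl, Sum.elim_inr, secondaryFirst_eq]
      simp [h]
    · exact h _
    · exact h _

end SecondaryConstraints

/-! ### Complete sets adapted to the primary constraints. -/

section Extension

variable {E : Type*} [NormedAddCommGroup E] [NormedSpace ℝ E]
  {P : Type*} [TopologicalSpace P] [ChartedSpace E P]
  {p q r t : ℕ} {φ : Fin p ⊕ Fin q → P → ℝ} {U V W S' S : Set P}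
  {σ : Fin r ↪ Fin p} {τ : Fin t ↪ Fin q} {α : {i // i ∉ Set.range σ} → Fin r → P → ℝ}
  {β : {j // j ∉ Set.range τ} → Fin r → P → ℝ} {γ : {j // j ∉ Set.range τ} → Fin t → P → ℝ}

theorem smoothOn_secondaryFirst (hφ : ∀ i, SmoothOn E (φ i) W)
    (hβ : ∀ j k, SmoothOn E (β j k) W) (hγ : ∀ j k, SmoothOn E (γ j k) W)
    (j : {j // j ∉ Set.range τ}) : SmoothOn E (secondaryFirst φ σ τ β γ j) W :=
  SmoothOn.add (SmoothOn.add (hφ _) (SmoothOn.finset_sum fun k _ => (hβ j k).mul (hφ _)))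
    (SmoothOn.finset_sum fun l _ => (hγ j l).mul (hφ _))

theorem mvfderiv_secondaryFirst (hW : IsOpen W) (hφ : ∀ i, SmoothOn E (φ i) W)
    (hβ : ∀ j k, SmoothOn E (β j k) W) (hγ : ∀ j k, SmoothOn E (γ j k) W) {x : P} (hx : x ∈ W)
    (h0 : ∀ i, φ i x = 0) (j : {j // j ∉ Set.range τ}) :
    mvfderiv 𝓘(ℝ, E) (secondaryFirst φ σ τ β γ j) x = mvfderiv 𝓘(ℝ, E) (φ (Sum.inr j.1)) x
      + ∑ k, Sum.elim (β j) (γ j) k x • mvfderiv 𝓘(ℝ, E) (φ (Sum.map σ τ k)) x := by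
  rw [secondaryFirst_eq]
  refine mvfderiv_add_sum_mul_of_eq_zero (SmoothOn.mdifferentiableAt (hφ _) hW hx)
    (fun k => ?_) (fun _ => SmoothOn.mdifferentiableAt (hφ _) hW hx) fun _ => h0 _
  cases k with
  | inl k => exact SmoothOn.mdifferentiableAt (hβ j k) hW hx
  | inr l => exact SmoothOn.mdifferentiableAt (hγ j l) hW hx

/-- The differentials of the adapted constraints are independent along `S`. -/
theorem linearIndependent_first_second (hS : RegularlyDefines E φ U S) (hW : IsOpen W)
    (hWU : W ⊆ U) (hα : ∀ i k, SmoothOn E (α i k) W) (hβ : ∀ j k, SmoothOn E (β j k) W)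
    (hγ : ∀ j k, SmoothOn E (γ j k) W) {x : P} (hx : x ∈ S ∩ W) :
    LinearIndependent ℝ fun k => mvfderiv 𝓘(ℝ, E)
      (Sum.elim (Sum.elim (primaryFirst φ σ α) (secondaryFirst φ σ τ β γ))
        (Sum.elim (primarySecond φ σ) (secondarySecond φ τ)) k) x := by
  have hφ := fun i => (hS.smooth i).mono hWU
  have h0 := (hS.mem_iff.1 hx.1).2
  refine linearIndependent_of_mem_span (hS.independent x hx.1) ?_ ?_
  · rw [← Fintype.card_congr (Equiv.sumCongr (complementSumEquiv σ) (complementSumEquiv τ))]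
    simp only [Fintype.card_sum]
    ring
  · have h2 : ∀ k, mvfderiv 𝓘(ℝ, E) (φ (Sum.map σ τ k)) x ∈ Submodule.span ℝ (Set.range fun k =>
        mvfderiv 𝓘(ℝ, E) (Sum.elim (Sum.elim (primaryFirst φ σ α) (secondaryFirst φ σ τ β γ))
          (Sum.elim (primarySecond φ σ) (secondarySecond φ τ)) k) x) := fun k =>
      Submodule.subset_span ⟨Sum.inr k, by cases k <;> rfl⟩
    rintro (i | j)
    · refine Submodule.span_mono ?_
        (primary_mem_span (α := α) (σ := σ) hW hφ hα hx.2 (fun i => h0 _) i)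
      rintro _ ⟨i | k, rfl⟩
      exacts [⟨Sum.inl (Sum.inl i), rfl⟩, ⟨Sum.inr (Sum.inl k), rfl⟩]
    · revert j
      refine forall_complement τ (fun j => ?_) (fun l => h2 (Sum.inr l))
      have h1 := mvfderiv_secondaryFirst (σ := σ) hW hφ hβ hγ hx.2 h0 j
      rw [← sub_eq_iff_eq_add] at h1
      rw [← h1]
      exact Submodule.sub_mem _ (Submodule.subset_span ⟨Sum.inl (Sum.inr j), rfl⟩)
        (Submodule.sum_mem _ fun k _ => Submodule.smul_mem _ _ (h2 k))

variable [FiniteDimensional ℝ E] [IsManifold 𝓘(ℝ, E) ∞ P] {Ω : SymplecticForm E P}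

/-- Along `S`, the differential of a primary first class constraint is a combination of those of the
`ψ'`. -/
theorem exists_mvfderiv_eq_sum_primaryFirst
    (hS' : RegularlyDefines E (fun i => φ (Sum.inl i)) U S') (hS : RegularlyDefines E φ U S)
    (hW : IsOpen W) (hWU : W ⊆ U) (hα : ∀ i k, SmoothOn E (α i k) W)
    (hfc : ∀ i, IsFirstClassConstraint Ω S W (primaryFirst φ σ α i)) {x : P} (hx : x ∈ S ∩ W)
    (hσ : LinearIndependent ℝ (fun k j => bracketMatrix Ω (primarySecond φ σ) φ x k j))
    {f : P → ℝ} (hf : IsFirstClassConstraint Ω S W f) (hf0 : ∀ x ∈ S' ∩ W, f x = 0) :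
    ∃ u : {i // i ∉ Set.range σ} → ℝ, mvfderiv 𝓘(ℝ, E) f x
      = ∑ i, u i • mvfderiv 𝓘(ℝ, E) (primaryFirst φ σ α i) x := by
  have hreg := regularlyDefines_primary (α := α) hS' hS.smooth hW hWU hα
  have hφ0 : ∀ i, ∀ x ∈ S ∩ W, φ i x = 0 := fun i x hx => (hS.mem_iff.1 hx.1).2 i
  have hφ := fun i => (hS.smooth i).mono hWU
  have hx' : x ∈ S' ∩ W := ⟨final_subset_primary hS' hS hx.1, hx.2⟩
  obtain ⟨a, ha⟩ := exists_eq_sum_of_forall_eq_zero (x := x)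
    (ξ := fun k => mvfderiv 𝓘(ℝ, E) (Sum.elim (primaryFirst φ σ α) (primarySecond φ σ) k) x)
    (η := mvfderiv 𝓘(ℝ, E) f x) fun v hv =>
      mvfderiv_eq_zero_of_mem_tangentTo (SmoothOn.mdifferentiableAt hf.smooth hW hx.2)
        (Eventually.of_forall hf0) ((hreg.mem_tangentTo_iff hx').2 hv)
  rw [Fintype.sum_sum_type] at ha
  -- Evaluated on X_{φ_j}, both df and the dψ' vanish, being first class. What remains is a relation
  -- between the independent rows of the χ'.
  have hzero : ∀ k, a (Sum.inr k) = 0 := by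
    refine Fintype.linearIndependent_iff.1 hσ _ ?_
    ext j
    have h1 := congrArg (fun ξ => ξ (hamField Ω (φ j) x)) ha
    simp only [add_apply, sum_apply, smul_apply, mvfderiv_hamField, Sum.elim_inl, Sum.elim_inr,
      (hfc _).poisson_eq_zero hW (hφ j) (hφ0 j) hx, hf.poisson_eq_zero hW (hφ j) (hφ0 j) hx,
      smul_zero, Finset.sum_const_zero, zero_add] at h1
    simpa [bracketMatrix] using h1.symm
  refine ⟨fun i => a (Sum.inl i), ?_⟩
  simpa [hzero] using ha

theorem exists_adapted_complete_set {s : ℕ}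
    (hS' : RegularlyDefines E (fun i => φ (Sum.inl i)) U S') (hS : RegularlyDefines E φ U S)
    (hΦ : ∀ x ∈ U, (bracketMatrix Ω φ φ x).rank = 2 * s)
    (hΦ' : ∀ x ∈ S, (bracketMatrix Ω (fun i => φ (Sum.inl i)) φ x).rank = r)
    (hV : IsOpen V) (hVU : V ⊆ U)
    (hσ : ∀ x ∈ S ∩ V, LinearIndependent ℝ
      (fun k j => bracketMatrix Ω (primarySecond φ σ) φ x k j))
    (hα : ∀ i k, SmoothOn E (α i k) V)
    (hfc : ∀ i, IsFirstClassConstraint Ω S V (primaryFirst φ σ α i)) {x₀ : P} (hx₀ : x₀ ∈ S ∩ V) :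
    ∃ W : Set P, IsOpen W ∧ x₀ ∈ W ∧ W ⊆ V ∧
      IsCompletePrimarySet Ω S' S W (primaryFirst φ σ α) (primarySecond φ σ) ∧
      ∃ (t : ℕ) (τ : Fin t ↪ Fin q) (β : {j // j ∉ Set.range τ} → Fin r → P → ℝ)
        (γ : {j // j ∉ Set.range τ} → Fin t → P → ℝ),
        r + t = 2 * s ∧ (∀ j k, SmoothOn E (β j k) W) ∧ (∀ j l, SmoothOn E (γ j l) W) ∧
        IsAdaptedCompleteSet Ω S' S W (primaryFirst φ σ α) (secondaryFirst φ σ τ β γ)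
          (primarySecond φ σ) (secondarySecond φ τ) := by
  classical
  obtain ⟨t, τ, ht, hτ⟩ := exists_linearIndependent_rows_extension (bracketMatrix Ω φ φ x₀) σ
    (hσ x₀ hx₀) fun i => by
      obtain ⟨u, hu⟩ := exists_row_eq_sum_of_rank
        (bracketMatrix Ω (fun i => φ (Sum.inl i)) φ x₀) σ
        ((hΦ' x₀ hx₀.1).trans (Fintype.card_fin r).symm) (hσ x₀ hx₀) i
      refine (Submodule.mem_span_range_iff_exists_fun ℝ).2 ⟨u, ?_⟩
      ext j
      have := hu j
      simpa [bracketMatrix] using this.symm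
  rw [Fintype.card_fin, hΦ x₀ (hVU hx₀.2)] at ht
  let χ : Fin r ⊕ Fin t → P → ℝ := fun k => φ (Sum.map σ τ k)
  let W₁ := V ∩ {x | LinearIndependent ℝ fun k j => bracketMatrix Ω χ φ x k j}
  have hφV := fun i => (hS.smooth i).mono hVU
  have hW₁ : IsOpen W₁ := isOpen_setOf_rows_linearIndependent Ω hV (fun k => hφV _) hφV
  have hx₁ : x₀ ∈ W₁ := ⟨hx₀.2, hτ⟩
  have hW₁V : W₁ ⊆ V := Set.inter_subset_left
  have hφ₁ := fun i => (hφV i).mono hW₁V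
  have hcard : 2 * s = Fintype.card (Fin r ⊕ Fin t) := by simp [ht]
  have hrows : ∀ x ∈ W₁, ∀ i, ∃ u : Fin r ⊕ Fin t → ℝ, ∀ j, poisson Ω (φ i) (φ j) x
      = ∑ k, u k * poisson Ω (χ k) (φ j) x := fun x hx i =>
    exists_row_eq_sum_of_rank (bracketMatrix Ω φ φ x) (Sum.map σ τ)
      ((hΦ x (hVU hx.1)).trans hcard) hx.2 i
  have hdet : ∀ x ∈ W₁, (bracketMatrix Ω χ χ x).det ≠ 0 := fun x hx =>
    det_ne_zero_of_antisymm (bracketMatrix Ω φ φ x)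
      (fun i j => poisson_antisymm Ω (φ i) (φ j) x) (Sum.map σ τ) hx.2 (hrows x hx)
  -- The whole space is taken for T, with N = 0: the rank of the full matrix is constant on U, so
  -- the relation between rows holds throughout W₁ and not only along S.
  have hc := fun i : {j // j ∉ Set.range τ} => exists_smoothOn_coefficients (W := W₁)
    (T := Set.univ) (N := fun _ => 0) (A := fun j => poisson Ω (φ (Sum.inr i.1)) (φ j))
    (R := fun k j => poisson Ω (χ k) (φ j))
    (fun j => SmoothOn.poisson Ω hW₁ (hφ₁ _) (hφ₁ _))
    (fun k j => SmoothOn.poisson Ω hW₁ (hφ₁ _) (hφ₁ _)) (smoothOn_const (E := E) 0)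
    (fun _ _ => rfl) (fun x _ hx => absurd (Set.mem_univ x) hx) (fun x hx => hx.2.2)
    fun x hx => hrows x hx.2 _
  choose c hcs hc using hc
  let β : {j // j ∉ Set.range τ} → Fin r → P → ℝ := fun j k x => -c j (Sum.inl k) x
  let γ : {j // j ∉ Set.range τ} → Fin t → P → ℝ := fun j l x => -c j (Sum.inr l) x
  have hβ : ∀ j k, SmoothOn E (β j k) W₁ := fun j k => (hcs j _).neg
  have hγ : ∀ j k, SmoothOn E (γ j k) W₁ := fun j k => (hcs j _).neg
  have hβγ : ∀ j k x, Sum.elim (β j) (γ j) k x = -c j k x := by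
    rintro j (k | l) x <;> rfl
  have hα₁ : ∀ i k, SmoothOn E (α i k) W₁ := fun i k => (hα i k).mono hW₁V
  let Ψ := Sum.elim (Sum.elim (primaryFirst φ σ α) (secondaryFirst φ σ τ β γ))
    (Sum.elim (primarySecond φ σ) (secondarySecond φ τ))
  have hΨ : ∀ k, SmoothOn E (Ψ k) W₁ := by
    rintro ((i | j) | (k | l))
    exacts [smoothOn_primaryFirst hφ₁ hα₁ i, smoothOn_secondaryFirst hφ₁ hβ hγ j, hφ₁ _, hφ₁ _]
  -- The conjugate functions g serve twice: they make the differentials independent off S too, and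
  -- their brackets with the ψ' are the independent rows from which the smooth coefficients b for
  -- maximality are computed.
  obtain ⟨W, hW, hxW, hWW₁, g, hg, hgdet⟩ := exists_conjugate_functions Ω hW₁ hΨ hx₁
    (linearIndependent_first_second hS hW₁ (hW₁V.trans hVU) hα₁ hβ hγ ⟨hx₀.1, hx₁⟩)
  have hWV := hWW₁.trans hW₁V
  have hWU := hWV.trans hVU
  have hind : ∀ x ∈ W, LinearIndependent ℝ fun k => mvfderiv 𝓘(ℝ, E) (Ψ k) x := fun x hx =>
    linearIndependent_mvfderiv_of_det_ne_zero Ω (hgdet x hx)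
  have hfcW := fun i => (hfc i).mono hWV
  have hαW : ∀ i k, SmoothOn E (α i k) W := fun i k => (hα i k).mono hWV
  have hreg' := regularlyDefines_primary (α := α) hS' hS.smooth hW hWU hαW
  have hprim : ∀ k, ∀ x ∈ S' ∩ W,
      (Sum.elim (primaryFirst φ σ α) (primarySecond φ σ) k) x = 0 := fun k x hx =>
    (hreg'.mem_iff.1 hx).2 k
  let ι : {i // i ∉ Set.range σ} ⊕ Fin r →
      ({i // i ∉ Set.range σ} ⊕ {j // j ∉ Set.range τ}) ⊕ (Fin r ⊕ Fin t) :=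
    Sum.map Sum.inl Sum.inl
  have hι : Function.Injective ι := Sum.map_injective.2 ⟨Sum.inl_injective, Sum.inl_injective⟩
  have hΨι : ∀ k, Ψ (ι k) = Sum.elim (primaryFirst φ σ α) (primarySecond φ σ) k := by
    rintro (i | k) <;> rfl
  refine ⟨W, hW, hxW, hWV, ⟨hreg', fun x hx => ?_, hfcW, fun f hf hf0 => ?_⟩, t, τ, β, γ, ht,
    fun j k => (hβ j k).mono hWW₁, fun j l => (hγ j l).mono hWW₁,
    ⟨⟨hW, fun k => (hΨ k).mono hWW₁, ?_, fun x hx => hind x hx.2⟩, hind, ?_, ?_⟩, ?_, ?_⟩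
  · have h1 := (hind x hx).comp ι hι
    simpa only [Function.comp_def, hΨι] using h1
  · obtain ⟨hN, hN0, hNpos⟩ := sum_sq_constraints hS hWU
    have hrowsΨ : ∀ x ∈ W, LinearIndependent ℝ fun (i : {i // i ∉ Set.range σ}) j =>
        poisson Ω (primaryFirst φ σ α i) (g j) x := fun x hx => by
      have h1 := Matrix.linearIndependent_rows_iff_isUnit.2
        ((Matrix.isUnit_iff_isUnit_det _).2 (isUnit_iff_ne_zero.2 (hgdet x hx)))
      exact h1.comp (fun i => Sum.inl (Sum.inl i)) (Sum.inl_injective.comp Sum.inl_injective)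
    have hu : ∀ x ∈ S ∩ W, ∃ u : {i // i ∉ Set.range σ} → ℝ, mvfderiv 𝓘(ℝ, E) f x
        = ∑ i, u i • mvfderiv 𝓘(ℝ, E) (primaryFirst φ σ α i) x := fun x hx =>
      exists_mvfderiv_eq_sum_primaryFirst hS' hS hW hWU hαW hfcW hx (hσ x ⟨hx.1, hWV hx.2⟩) hf hf0
    have hu' : ∀ {x : P} {u : {i // i ∉ Set.range σ} → ℝ}, mvfderiv 𝓘(ℝ, E) f x
        = ∑ i, u i • mvfderiv 𝓘(ℝ, E) (primaryFirst φ σ α i) x → ∀ j, poisson Ω f (g j) x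
          = ∑ i, u i * poisson Ω (primaryFirst φ σ α i) (g j) x := fun h j => by
      simp only [← mvfderiv_hamField, h, sum_apply, smul_apply, smul_eq_mul]
    obtain ⟨b, hb, hbS⟩ := exists_smoothOn_coefficients (W := W) (T := S)
      (A := fun j => poisson Ω f (g j))
      (R := fun i j => poisson Ω (primaryFirst φ σ α i) (g j))
      (fun j => SmoothOn.poisson Ω hW hf.smooth (hg j))
      (fun i j => SmoothOn.poisson Ω hW (hfcW i).smooth (hg j)) hN hN0 hNpos
      (fun x hx => hrowsΨ x hx.2) fun x hx => (hu x hx).imp fun u h => hu' h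
    refine ⟨b, hb, fun x hx => ?_⟩
    obtain ⟨u, h⟩ := hu x hx
    -- The pointwise coefficients u satisfy the identity of differentials, whereas b is only known
    -- to satisfy its brackets with the g; independence of the rows identifies the two.
    have hbu : ∀ i, u i - b i x = 0 := by
      refine Fintype.linearIndependent_iff.1 (hrowsΨ x hx.2) _ ?_
      ext j
      have h2 := hbS x hx j
      rw [hu' h j] at h2
      simpa [sub_mul, sub_eq_zero] using h2
    rw [h]
    exact Finset.sum_congr rfl fun i _ => by rw [sub_eq_zero.1 (hbu i)]
  · ext x
    rw [Set.mem_inter_iff, hS.mem_iff, Set.mem_ofPred_eq, first_second_eq_zero_iff]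
    exact ⟨fun h => ⟨h.2, h.1.2⟩, fun h => ⟨⟨hWU h.1, h.2⟩, h.1⟩⟩
  · rintro (i | j)
    · exact hfcW i
    · refine ⟨(smoothOn_secondaryFirst hφ₁ hβ hγ j).mono hWW₁, fun x hx => ?_, fun x hx => ?_⟩
      · exact (first_second_eq_zero_iff (α := α)).2 (hS.mem_iff.1 hx.1).2 (Sum.inl (Sum.inr j))
      · refine (hS.hamField_mem_tangentTo_iff Ω hx.1).2 fun i => ?_
        rw [Sum.elim_inr, poisson_left_eq_add_sum Ω (mvfderiv_secondaryFirst hW₁ hφ₁ hβ hγ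
          (hWW₁ hx.2) (hS.mem_iff.1 hx.1).2 j), hc j x ⟨trivial, hWW₁ hx.2⟩ i]
        simp [hβγ, χ]
  · intro x hx
    rw [second_eq_comp_map]
    exact hdet x (hWW₁ hx)
  · exact fun i => hprim (Sum.inl i)
  · exact fun k => hprim (Sum.inr k)

end Extension

/-! ### Equations of motion and the Dirac field of the abridged energy. -/

section Evolution

variable {E : Type*} [NormedAddCommGroup E] [NormedSpace ℝ E] [FiniteDimensional ℝ E]
  {P : Type*} [TopologicalSpace P] [ChartedSpace E P]
  {Ω : SymplecticForm E P} {p q r t : ℕ} {φ : Fin p ⊕ Fin q → P → ℝ} {U W S' S : Set P}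
  {σ : Fin r ↪ Fin p} {τ : Fin t ↪ Fin q} {α : {i // i ∉ Set.range σ} → Fin r → P → ℝ}
  {ψ'' : {j // j ∉ Set.range τ} → P → ℝ} {H : P → ℝ}

theorem diracField_abridgedEnergy {κ : Type*} [Fintype κ] [DecidableEq κ] (χ : κ → P → ℝ)
    (hW : IsOpen W) (hφ : ∀ i, SmoothOn E (φ i) W) (hH : SmoothOn E H W)
    {x : P} (hx : x ∈ W) (l : {i // i ∉ Set.range σ} → ℝ) :
    diracField Ω χ (abridgedEnergy φ σ H l) x
      = diracField Ω χ H x + ∑ i, l i • diracField Ω χ (φ (Sum.inl i.1)) x :=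
  diracField_eq_add_sum Ω χ (mvfderiv_add_sum_const_mul l
    (SmoothOn.mdifferentiableAt hH hW hx) fun _ => SmoothOn.mdifferentiableAt (hφ _) hW hx)

theorem mvfderiv_diracField_abridgedEnergy {κ : Type*} [Fintype κ] [DecidableEq κ]
    (χ : κ → P → ℝ) (hW : IsOpen W) (hφ : ∀ i, SmoothOn E (φ i) W) (hH : SmoothOn E H W)
    {x : P} (hx : x ∈ W) (l : {i // i ∉ Set.range σ} → ℝ) (F : P → ℝ) :
    mvfderiv 𝓘(ℝ, E) F x (diracField Ω χ (abridgedEnergy φ σ H l) x)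
      = diracBracket Ω χ F H x + ∑ i, l i * diracBracket Ω χ F (φ (Sum.inl i.1)) x := by
  rw [diracField_abridgedEnergy χ hW hφ hH hx]
  simp only [map_add, map_sum, map_smul, mvfderiv_diracField, smul_eq_mul]

theorem poisson_unselected_primary (hS : RegularlyDefines E φ U S) (hW : IsOpen W) (hWU : W ⊆ U)
    (hα : ∀ i k, SmoothOn E (α i k) W)
    (hfc : ∀ i, IsFirstClassConstraint Ω S W (primaryFirst φ σ α i)) {x : P} (hx : x ∈ S ∩ W)
    (i : {i // i ∉ Set.range σ}) (j : Fin p ⊕ Fin q) :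
    poisson Ω (φ (Sum.inl i.1)) (φ j) x
      = -∑ k, α i k x * poisson Ω (primarySecond φ σ k) (φ j) x := by
  have hφ := fun i => (hS.smooth i).mono hWU
  have h1 := (hfc i).poisson_eq_zero hW (hφ j) (fun y hy => (hS.mem_iff.1 hy.1).2 j) hx
  rw [poisson_left_eq_add_sum Ω (mvfderiv_primaryFirst hW hφ hα hx.2
    (fun i => (hS.mem_iff.1 hx.1).2 _) i)] at h1
  exact eq_neg_of_add_eq_zero_left h1

/-- At points of `S`, multipliers exist with arbitrary values on the unselected indices. -/
theorem exists_multipliers_extending (hS : RegularlyDefines E φ U S) (hW : IsOpen W) (hWU : W ⊆ U)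
    (hα : ∀ i k, SmoothOn E (α i k) W)
    (hfc : ∀ i, IsFirstClassConstraint Ω S W (primaryFirst φ σ α i)) {x : P} (hx : x ∈ S ∩ W)
    (hne : (multipliers Ω φ H x).Nonempty) (l : {i // i ∉ Set.range σ} → ℝ) :
    ∃ m ∈ multipliers Ω φ H x, ∀ i : {i // i ∉ Set.range σ}, m i = l i := by
  obtain ⟨m₀, hm₀⟩ := hne
  -- Changing the unselected multipliers by l − m₀ is compensated on the selected ones by the
  -- coefficients α: the total change is a combination of the ψ', which have vanishing brackets with
  -- all constraints on S.
  refine ⟨fun i => Sum.elim l (fun k => m₀ (σ k) + ∑ i, (l i - m₀ i.1) * α i k x)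
    ((complementSumEquiv σ).symm i), fun j => ?_, fun i => ?_⟩
  · have h1 := hm₀ j
    rw [sum_eq_sum_complement_add σ] at h1 ⊢
    simp only [complementSumEquiv_symm_val, complementSumEquiv_symm_apply, Sum.elim_inl,
      Sum.elim_inr]
    simp only [poisson_unselected_primary hS hW hWU hα hfc hx] at h1 ⊢
    have h2 : ∑ k, (∑ i : {i // i ∉ Set.range σ}, (l i - m₀ i.1) * α i k x)
          * poisson Ω (φ (Sum.inl (σ k))) (φ j) x
        = ∑ i : {i // i ∉ Set.range σ}, (l i - m₀ i.1) *
          ∑ k, α i k x * poisson Ω (primarySecond φ σ k) (φ j) x := by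
      simp only [Finset.sum_mul, Finset.mul_sum]
      rw [Finset.sum_comm]
      exact Finset.sum_congr rfl fun i _ => Finset.sum_congr rfl fun k _ => mul_assoc _ _ _
    simp only [add_mul, Finset.sum_add_distrib]
    rw [h2]
    simp only [sub_mul, Finset.sum_sub_distrib, mul_neg, Finset.sum_neg_distrib] at h1 ⊢
    linarith
  · simp only [complementSumEquiv_symm_val, Sum.elim_inl]

/-- Only the unselected primary constraints contribute to the Dirac field of the total energy. -/
theorem diracField_add_sum_primary (hdet : ∀ x ∈ W, (bracketMatrix Ω (Sum.elim (primarySecond φ σ)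
      (secondarySecond φ τ)) (Sum.elim (primarySecond φ σ) (secondarySecond φ τ)) x).det ≠ 0)
    (hW : IsOpen W) (hφ : ∀ i, SmoothOn E (φ i) W) (hH : SmoothOn E H W) {x : P} (hx : x ∈ W)
    (l : Fin p → ℝ) :
    diracField Ω (Sum.elim (primarySecond φ σ) (secondarySecond φ τ)) H x
      + ∑ i, l i • diracField Ω (Sum.elim (primarySecond φ σ) (secondarySecond φ τ))
        (φ (Sum.inl i)) x
      = diracField Ω (Sum.elim (primarySecond φ σ) (secondarySecond φ τ))
        (abridgedEnergy φ σ H fun i => l i) x := by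
  rw [diracField_abridgedEnergy _ hW hφ hH hx, sum_eq_sum_complement_add σ]
  have h1 : ∀ k, diracField Ω (Sum.elim (primarySecond φ σ) (secondarySecond φ τ))
      (φ (Sum.inl (σ k))) x = 0 := fun k => diracField_second_class Ω (hdet x hx) (Sum.inl k)
  simp only [h1, smul_zero, Finset.sum_const_zero, add_zero]

/-- A total energy has the same Hamiltonian and Dirac fields, if the multipliers solve the
consistency conditions. -/
theorem hamField_eq_diracField_of_multipliers {x : P} {m : Fin p → ℝ}
    (hm : m ∈ multipliers Ω φ H x) {f : P → ℝ}
    (hf : mvfderiv 𝓘(ℝ, E) f x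
      = mvfderiv 𝓘(ℝ, E) H x + ∑ i, m i • mvfderiv 𝓘(ℝ, E) (φ (Sum.inl i)) x) :
    diracField Ω (Sum.elim (primarySecond φ σ) (secondarySecond φ τ)) f x = hamField Ω f x := by
  refine diracField_eq_hamField Ω fun k => ?_
  rw [poisson_antisymm, neg_eq_zero, poisson_left_eq_add_sum Ω hf, second_eq_comp_map]
  exact hm _

variable [IsManifold 𝓘(ℝ, E) ∞ P]

omit [IsManifold 𝓘(ℝ, E) ∞ P] in
-- On S, φ_i and ψ'_i have the same Dirac field because they differ by Casimirs χ' with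
-- coefficients. For ψ'_i the Dirac correction vanishes, since its brackets with all χ are zero on
-- S.
theorem diracField_unselected_primary
    (hC : IsAdaptedCompleteSet Ω S' S W (primaryFirst φ σ α) ψ''
      (primarySecond φ σ) (secondarySecond φ τ))
    (hS : RegularlyDefines E φ U S) (hWU : W ⊆ U)
    (hα : ∀ i k, SmoothOn E (α i k) W) {x : P} (hx : x ∈ S ∩ W)
    (i : {i // i ∉ Set.range σ}) :
    diracField Ω (Sum.elim (primarySecond φ σ) (secondarySecond φ τ)) (φ (Sum.inl i.1)) x
      = hamField Ω (primaryFirst φ σ α i) x := by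
  have hW := hC.complete.regular.isOpen
  have hφ := fun i => (hS.smooth i).mono hWU
  have h0 := (hS.mem_iff.1 hx.1).2
  have h1 : diracField Ω (Sum.elim (primarySecond φ σ) (secondarySecond φ τ))
      (primaryFirst φ σ α i) x = hamField Ω (primaryFirst φ σ α i) x := by
    refine diracField_eq_hamField Ω fun k => ?_
    rw [poisson_antisymm, neg_eq_zero, second_eq_comp_map]
    exact (hC.complete.firstClass (Sum.inl i)).poisson_eq_zero hW (hφ _)
      (fun y hy => (hS.mem_iff.1 hy.1).2 _) hx
  rw [← h1, diracField_eq_add_sum Ω _ (mvfderiv_primaryFirst hW hφ hα hx.2 (fun i => h0 _) i)]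
  have h2 : ∀ k, diracField Ω (Sum.elim (primarySecond φ σ) (secondarySecond φ τ))
      (primarySecond φ σ k) x = 0 := fun k =>
    diracField_second_class Ω (hC.complete.secondClass x hx.2) (Sum.inl k)
  simp only [h2, smul_zero, Finset.sum_const_zero, add_zero]

/-- Tangency is tested on the defining functions ψ and χ. The χ are Casimirs; on a ψ, the brackets
with H and with all φ vanish, hence also every correction term. -/
theorem diracField_abridgedEnergy_mem_tangentTo
    (hC : IsAdaptedCompleteSet Ω S' S W (primaryFirst φ σ α) ψ''
      (primarySecond φ σ) (secondarySecond φ τ))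
    (hS : RegularlyDefines E φ U S) (hWU : W ⊆ U) (hH : SmoothOn E H W) {x : P} (hx : x ∈ S ∩ W)
    (hHψ : ∀ k, poisson Ω H (Sum.elim (primaryFirst φ σ α) ψ'' k) x = 0)
    (l : {i // i ∉ Set.range σ} → ℝ) :
    diracField Ω (Sum.elim (primarySecond φ σ) (secondarySecond φ τ))
      (abridgedEnergy φ σ H l) x ∈ tangentTo E (S ∩ W) x := by
  have hW := hC.complete.regular.isOpen
  have hφ := fun i => (hS.smooth i).mono hWU
  rw [hC.complete.regular.mem_tangentTo_iff hx]
  rintro (k | k)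
  · have h1 : ∀ j, poisson Ω (Sum.elim (primaryFirst φ σ α) ψ'' k) (φ j) x = 0 := fun j =>
      (hC.complete.firstClass k).poisson_eq_zero hW (hφ j)
        (fun y hy => (hS.mem_iff.1 hy.1).2 _) hx
    have h2 : poisson Ω (Sum.elim (primaryFirst φ σ α) ψ'' k) H x = 0 := by
      rw [poisson_antisymm, hHψ, neg_zero]
    rw [mvfderiv_diracField_abridgedEnergy _ hW hφ hH hx.2, Sum.elim_inl, second_eq_comp_map]
    simp [diracBracket, h1, h2]
  · rw [mvfderiv_diracField, Sum.elim_inr,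
      diracBracket_second_class Ω (hC.complete.secondClass x hx.2)]

omit [IsManifold 𝓘(ℝ, E) ∞ P] in
theorem diracField_abridgedEnergy_injective
    (hC : IsAdaptedCompleteSet Ω S' S W (primaryFirst φ σ α) ψ''
      (primarySecond φ σ) (secondarySecond φ τ))
    (hS : RegularlyDefines E φ U S) (hWU : W ⊆ U)
    (hα : ∀ i k, SmoothOn E (α i k) W) (hH : SmoothOn E H W) {x : P} (hx : x ∈ S ∩ W) :
    Function.Injective fun l : {i // i ∉ Set.range σ} → ℝ =>
      diracField Ω (Sum.elim (primarySecond φ σ) (secondarySecond φ τ))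
        (abridgedEnergy φ σ H l) x := by
  intro l m hlm
  have hφ := fun i => (hS.smooth i).mono hWU
  simp only [diracField_abridgedEnergy _ hC.complete.regular.isOpen hφ hH hx.2,
    diracField_unselected_primary hC hS hWU hα hx, add_right_inj] at hlm
  have hind : LinearIndependent ℝ fun i => mvfderiv 𝓘(ℝ, E) (primaryFirst φ σ α i) x :=
    (hC.complete.independent x hx.2).comp (fun i => Sum.inl (Sum.inl i))
      (Sum.inl_injective.comp Sum.inl_injective)
  have h1 := congrArg (Ω.form x) hlm
  simp only [map_sum, map_smul, form_hamField] at h1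
  have h2 : ∑ i, (l i - m i) • mvfderiv 𝓘(ℝ, E) (primaryFirst φ σ α i) x = 0 := by
    simp only [sub_smul, Finset.sum_sub_distrib, h1, sub_self]
  exact funext fun i => sub_eq_zero.1 (Fintype.linearIndependent_iff.1 hind _ h2 i)

omit [IsManifold 𝓘(ℝ, E) ∞ P] in
/-- The field of the total energy with constant multipliers that solve the consistency conditions
is the Dirac field of the abridged total energy. -/
theorem hamField_add_sum_eq_diracField_abridgedEnergy (hW : IsOpen W)
    (hφ : ∀ i, SmoothOn E (φ i) W) (hH : SmoothOn E H W)
    (hdet : ∀ x ∈ W, (bracketMatrix Ω (Sum.elim (primarySecond φ σ)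
      (secondarySecond φ τ)) (Sum.elim (primarySecond φ σ) (secondarySecond φ τ)) x).det ≠ 0)
    {x : P} (hx : x ∈ W) {m : Fin p → ℝ} (hm : m ∈ multipliers Ω φ H x) :
    hamField Ω H x + ∑ i, m i • hamField Ω (φ (Sum.inl i)) x
      = diracField Ω (Sum.elim (primarySecond φ σ) (secondarySecond φ τ))
        (abridgedEnergy φ σ H fun i => m i) x := by
  have h1 := mvfderiv_add_sum_const_mul m (SmoothOn.mdifferentiableAt hH hW hx)
    fun i => SmoothOn.mdifferentiableAt (hφ (Sum.inl i)) hW hx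
  rw [← diracField_add_sum_primary hdet hW hφ hH hx, ← diracField_eq_add_sum Ω _ h1,
    hamField_eq_diracField_of_multipliers hm h1, hamField_eq_add_sum Ω h1]

/-- The Lagrange multiplier argument: a covector annihilating the tangent space of S' is a
combination of the primary differentials. For the resulting field, tangency to S is, up to sign, the
definition of `multipliers`. -/
theorem solvesMotion_iff_exists_multipliers
    (hS' : RegularlyDefines E (fun i => φ (Sum.inl i)) U S') (hS : RegularlyDefines E φ U S)
    {x : P} (hx : x ∈ S) {v : TangentSpace 𝓘(ℝ, E) x} :
    SolvesMotion Ω S' S H x v ↔ ∃ l ∈ multipliers Ω φ H x,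
      v = hamField Ω H x + ∑ i, l i • hamField Ω (φ (Sum.inl i)) x := by
  have hx' := final_subset_primary hS' hS hx
  have hform : ∀ l : Fin p → ℝ, Ω.form x (hamField Ω H x
      + ∑ i, l i • hamField Ω (φ (Sum.inl i)) x)
      = mvfderiv 𝓘(ℝ, E) H x + ∑ i, l i • mvfderiv 𝓘(ℝ, E) (φ (Sum.inl i)) x := fun l => by
    simp only [map_add, map_sum, map_smul, form_hamField]
  have htangent : ∀ l : Fin p → ℝ, hamField Ω H x + ∑ i, l i • hamField Ω (φ (Sum.inl i)) x
      ∈ tangentTo E S x ↔ l ∈ multipliers Ω φ H x := fun l => by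
    rw [hS.mem_tangentTo_iff hx]
    refine forall_congr' fun j => ?_
    rw [← neg_eq_zero]
    simp only [map_add, map_sum, map_smul, mvfderiv_hamField, smul_eq_mul, neg_add,
      ← Finset.sum_neg_distrib, ← mul_neg, ← poisson_antisymm]
  constructor
  · rintro ⟨hvS, hv⟩
    obtain ⟨l, hl⟩ := exists_eq_sum_of_forall_eq_zero (x := x)
      (ξ := fun i => mvfderiv 𝓘(ℝ, E) (φ (Sum.inl i)) x)
      (η := Ω.form x v - mvfderiv 𝓘(ℝ, E) H x) fun δ hδ =>
        sub_eq_zero.2 (hv δ ((hS'.mem_tangentTo_iff hx').2 hδ))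
    have hvl : v = hamField Ω H x + ∑ i, l i • hamField Ω (φ (Sum.inl i)) x :=
      (Ω.form_bijective x).1 (by rw [hform, ← hl, add_sub_cancel])
    exact ⟨l, (htangent l).1 (hvl ▸ hvS), hvl⟩
  · rintro ⟨l, hl, rfl⟩
    refine ⟨(htangent l).2 hl, fun δ hδ => ?_⟩
    have h1 := (hS'.mem_tangentTo_iff hx').1 hδ
    rw [hform]
    simp [h1]

/-- Restricting a multiplier to the unselected indices gives existence. Conversely, a solution of
the multiplier condition with the prescribed unselected values is needed, and this is where
nonemptiness of `multipliers` enters. -/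
theorem solvesMotion_iff_exists_diracField
    (hC : IsAdaptedCompleteSet Ω S' S W (primaryFirst φ σ α) ψ''
      (primarySecond φ σ) (secondarySecond φ τ))
    (hS' : RegularlyDefines E (fun i => φ (Sum.inl i)) U S') (hS : RegularlyDefines E φ U S)
    (hWU : W ⊆ U) (hα : ∀ i k, SmoothOn E (α i k) W) (hH : SmoothOn E H W) {x : P}
    (hx : x ∈ S ∩ W) (hne : (multipliers Ω φ H x).Nonempty) {v : TangentSpace 𝓘(ℝ, E) x} :
    SolvesMotion Ω S' S H x v ↔ ∃! l : {i // i ∉ Set.range σ} → ℝ,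
      v = diracField Ω (Sum.elim (primarySecond φ σ) (secondarySecond φ τ))
        (abridgedEnergy φ σ H l) x := by
  have hW := hC.complete.regular.isOpen
  have hφ := fun i => (hS.smooth i).mono hWU
  have hfield := fun (m : Fin p → ℝ) (hm : m ∈ multipliers Ω φ H x) =>
    hamField_add_sum_eq_diracField_abridgedEnergy hW hφ hH hC.complete.secondClass hx.2 hm
  rw [solvesMotion_iff_exists_multipliers hS' hS hx.1]
  constructor
  · rintro ⟨m, hm, rfl⟩
    exact ⟨fun i => m i, hfield m hm, fun l hl =>
      diracField_abridgedEnergy_injective hC hS hWU hα hH hx (hl.symm.trans (hfield m hm))⟩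
  · rintro ⟨l, rfl, -⟩
    obtain ⟨m, hm, hml⟩ := exists_multipliers_extending hS hW hWU hα
      (fun i => hC.complete.firstClass (Sum.inl i)) hx hne l
    refine ⟨m, hm, ?_⟩
    rw [hfield m hm]
    congr 2
    exact (funext hml).symm

/-- With the unselected multipliers held constant, the consistency conditions are a linear system
for the selected ones whose rows are independent on S, and it is solvable at each point of S ∩ W. -/
theorem exists_smooth_multipliers (hS : RegularlyDefines E φ U S) (hW : IsOpen W) (hWU : W ⊆ U)
    (hσ : ∀ x ∈ S ∩ W, LinearIndependent ℝ
      (fun k j => bracketMatrix Ω (primarySecond φ σ) φ x k j))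
    (hα : ∀ i k, SmoothOn E (α i k) W)
    (hfc : ∀ i, IsFirstClassConstraint Ω S W (primaryFirst φ σ α i)) (hH : SmoothOn E H W)
    (hne : ∀ x ∈ S ∩ W, (multipliers Ω φ H x).Nonempty) (l : {i // i ∉ Set.range σ} → ℝ) :
    ∃ L : Fin p → P → ℝ, (∀ i, SmoothOn E (L i) W) ∧
      (∀ i : {i // i ∉ Set.range σ}, ∀ x ∈ W, L i x = l i) ∧
      ∀ x ∈ S ∩ W, (fun i => L i x) ∈ multipliers Ω φ H x := by
  have hφ := fun i => (hS.smooth i).mono hWU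
  obtain ⟨hN, hN0, hNpos⟩ := sum_sq_constraints hS hWU
  obtain ⟨c, hc, hcS⟩ := exists_smoothOn_coefficients (T := S)
    (A := fun j x => -(poisson Ω H (φ j) x
      + ∑ i : {i // i ∉ Set.range σ}, l i * poisson Ω (φ (Sum.inl i.1)) (φ j) x))
    (R := fun k j => poisson Ω (primarySecond φ σ k) (φ j))
    (fun j => ((SmoothOn.poisson Ω hW hH (hφ j)).add (SmoothOn.finset_sum fun i _ =>
      (smoothOn_const _).mul (SmoothOn.poisson Ω hW (hφ _) (hφ j)))).neg)
    (fun k j => SmoothOn.poisson Ω hW (hφ _) (hφ j)) hN hN0 hNpos hσ fun x hx => by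
      obtain ⟨m, hm, hml⟩ := exists_multipliers_extending hS hW hWU hα hfc hx (hne x hx) l
      refine ⟨fun k => m (σ k), fun j => ?_⟩
      have h1 := hm j
      rw [sum_eq_sum_complement_add σ, ← add_assoc] at h1
      simp only [hml] at h1
      exact (eq_neg_of_add_eq_zero_right h1).symm
  let L : Fin p → P → ℝ := fun i =>
    Sum.elim (fun i _ => l i) c ((complementSumEquiv σ).symm i)
  have hL1 : ∀ i : {i // i ∉ Set.range σ}, L i = fun _ => l i := fun i => by
    simp only [L, complementSumEquiv_symm_val, Sum.elim_inl]
  have hL2 : ∀ k, L (σ k) = c k := fun k => by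
    simp only [L, complementSumEquiv_symm_apply, Sum.elim_inr]
  refine ⟨L, forall_complement σ (fun i => ?_) (fun k => ?_), fun i x _ => ?_, fun x hx j => ?_⟩
  · rw [hL1]
    exact smoothOn_const _
  · rw [hL2]
    exact hc k
  · rw [hL1]
  · rw [sum_eq_sum_complement_add σ, ← add_assoc]
    simp only [hL1, hL2]
    exact neg_eq_iff_add_eq_zero.1 (hcS x hx j)

omit [IsManifold 𝓘(ℝ, E) ∞ P] in
-- Since the φ vanish on S, the differentials of the multipliers do not contribute there, and the
-- case of constant multipliers applies pointwise.
theorem total_energy_fields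
    (hC : IsAdaptedCompleteSet Ω S' S W (primaryFirst φ σ α) ψ''
      (primarySecond φ σ) (secondarySecond φ τ))
    (hS : RegularlyDefines E φ U S) (hWU : W ⊆ U) (hH : SmoothOn E H W) {L : Fin p → P → ℝ}
    (hL : ∀ i, SmoothOn E (L i) W) {x : P} (hx : x ∈ S ∩ W)
    (hm : (fun i => L i x) ∈ multipliers Ω φ H x) :
    hamField Ω (fun y => H y + ∑ i, L i y * φ (Sum.inl i) y) x
      = diracField Ω (Sum.elim (primarySecond φ σ) (secondarySecond φ τ))
        (abridgedEnergy φ σ H (fun i => L i x)) x ∧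
    diracField Ω (Sum.elim (primarySecond φ σ) (secondarySecond φ τ))
        (fun y => H y + ∑ i, L i y * φ (Sum.inl i) y) x
      = diracField Ω (Sum.elim (primarySecond φ σ) (secondarySecond φ τ))
        (abridgedEnergy φ σ H (fun i => L i x)) x := by
  have hW := hC.complete.regular.isOpen
  have hφ := fun i => (hS.smooth i).mono hWU
  have h1 := mvfderiv_add_sum_mul_of_eq_zero (SmoothOn.mdifferentiableAt hH hW hx.2)
    (fun i => SmoothOn.mdifferentiableAt (hL i) hW hx.2)
    (fun i => SmoothOn.mdifferentiableAt (hφ (Sum.inl i)) hW hx.2)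
    (fun i => (hS.mem_iff.1 hx.1).2 _)
  have h2 := hamField_add_sum_eq_diracField_abridgedEnergy hW hφ hH hC.complete.secondClass hx.2 hm
  have h3 := hamField_eq_add_sum Ω h1
  refine ⟨h3.trans h2, ?_⟩
  rw [hamField_eq_diracField_of_multipliers hm h1, h3, h2]

end Evolution

end DiracConstraints

/-! ### The theorem. -/

open DiracConstraints in
theorem theorem3p15
    {E : Type*} [NormedAddCommGroup E] [NormedSpace ℝ E] [FiniteDimensional ℝ E]
    {P : Type*} [TopologicalSpace P] [ChartedSpace E P] [IsManifold 𝓘(ℝ, E) ∞ P]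
    (Ω : SymplecticForm E P) {p q s s' : ℕ} (φ : Fin p ⊕ Fin q → P → ℝ) {U S' S : Set P}
    -- the primary and final constraint submanifolds are regularly defined on `U`
    (hS' : RegularlyDefines E (fun i => φ (Sum.inl i)) U S')
    (hS : RegularlyDefines E φ U S)
    -- the matrices of Poisson brackets have constant rank
    (hΦ : ∀ x ∈ U, (bracketMatrix Ω φ φ x).rank = 2 * s)
    (hΦ' : ∀ x ∈ S, (bracketMatrix Ω (fun i => φ (Sum.inl i)) φ x).rank = s') :
    -- near every point of `S`, `s'` linearly independent rows can be chosen
    (∀ x₀ ∈ S, ∃ (σ : Fin s' ↪ Fin p) (V : Set P), IsOpen V ∧ x₀ ∈ V ∧ V ⊆ U ∧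
      ∀ x ∈ S ∩ V, LinearIndependent ℝ
        (fun k j => bracketMatrix Ω (primarySecond φ σ) φ x k j)) ∧
    -- for every such choice on an open set `V`:
    ∀ (σ : Fin s' ↪ Fin p) (V : Set P), IsOpen V → V ⊆ U →
      (∀ x ∈ S ∩ V, LinearIndependent ℝ
        (fun k j => bracketMatrix Ω (primarySecond φ σ) φ x k j)) →
      -- coefficients that make the `ψ'` first class exist on all of `V`
      (∃ α : {i // i ∉ Set.range σ} → Fin s' → P → ℝ, (∀ i k, SmoothOn E (α i k) V) ∧
        (∀ i, IsFirstClassConstraint Ω S V (primaryFirst φ σ α i)) ∧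
        RegularlyDefines E (Sum.elim (primaryFirst φ σ α) (primarySecond φ σ)) V (S' ∩ V)) ∧
      -- and for all such coefficients:
      ∀ α : {i // i ∉ Set.range σ} → Fin s' → P → ℝ, (∀ i k, SmoothOn E (α i k) V) →
        (∀ i, IsFirstClassConstraint Ω S V (primaryFirst φ σ α i)) →
        -- locally, `(ψ', χ')` is a complete set of primary constraints and extends to an adapted
        -- complete set of first and second class constraints
        (∀ x₀ ∈ S ∩ V, ∃ W : Set P, IsOpen W ∧ x₀ ∈ W ∧ W ⊆ V ∧
          IsCompletePrimarySet Ω S' S W (primaryFirst φ σ α) (primarySecond φ σ) ∧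
          ∃ (t : ℕ) (τ : Fin t ↪ Fin q) (β : {j // j ∉ Set.range τ} → Fin s' → P → ℝ)
            (γ : {j // j ∉ Set.range τ} → Fin t → P → ℝ),
            s' + t = 2 * s ∧ (∀ j k, SmoothOn E (β j k) W) ∧ (∀ j l, SmoothOn E (γ j l) W) ∧
            IsAdaptedCompleteSet Ω S' S W (primaryFirst φ σ α) (secondaryFirst φ σ τ β γ)
              (primarySecond φ σ) (secondarySecond φ τ)) ∧
        -- for every such adapted complete set and every energy `H` whose brackets with the first
        -- class constraints vanish on `S`:
        (∀ (W : Set P) (t : ℕ) (τ : Fin t ↪ Fin q) (ψ'' : {j // j ∉ Set.range τ} → P → ℝ),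
          IsOpen W → W ⊆ V →
          IsAdaptedCompleteSet Ω S' S W (primaryFirst φ σ α) ψ''
            (primarySecond φ σ) (secondarySecond φ τ) →
          ∀ (χ : Fin s' ⊕ Fin t → P → ℝ),
            χ = Sum.elim (primarySecond φ σ) (secondarySecond φ τ) →
          ∀ H : P → ℝ, SmoothOn E H W →
            (∀ x ∈ S ∩ W, (∀ i, poisson Ω H (primaryFirst φ σ α i) x = 0) ∧
              ∀ j, poisson Ω H (ψ'' j) x = 0) →
            -- the Dirac-bracket field of the abridged total energy, as a vector field on `W`
            (∀ x ∈ W, ∀ l : {i // i ∉ Set.range σ} → ℝ,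
              diracField Ω χ (abridgedEnergy φ σ H l) x
                = diracField Ω χ H x + ∑ i, l i • diracField Ω χ (φ (Sum.inl i.1)) x ∧
              ∀ F : P → ℝ, ContMDiffAt 𝓘(ℝ, E) 𝓘(ℝ, ℝ) ∞ F x →
                mvfderiv 𝓘(ℝ, E) F x (diracField Ω χ (abridgedEnergy φ σ H l) x)
                  = diracBracket Ω χ F H x
                    + ∑ i, l i * diracBracket Ω χ F (φ (Sum.inl i.1)) x) ∧
            -- it is tangent to `S`, and the evolution of `F` depends only on `F` restricted to `S`
            (∀ x ∈ S ∩ W, ∀ l : {i // i ∉ Set.range σ} → ℝ,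
              diracField Ω χ (abridgedEnergy φ σ H l) x ∈ tangentTo E S x ∧
              ∀ F G : P → ℝ, ContMDiffAt 𝓘(ℝ, E) 𝓘(ℝ, ℝ) ∞ F x →
                ContMDiffAt 𝓘(ℝ, E) 𝓘(ℝ, ℝ) ∞ G x → (∀ y ∈ S ∩ W, F y = G y) →
                diracBracket Ω χ F H x + ∑ i, l i * diracBracket Ω χ F (φ (Sum.inl i.1)) x
                  = diracBracket Ω χ G H x
                    + ∑ i, l i * diracBracket Ω χ G (φ (Sum.inl i.1)) x) ∧
            -- it gives the equations of motion wherever these have multipliers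
            (∀ x ∈ S ∩ W, (multipliers Ω φ H x).Nonempty → ∀ v : TangentSpace 𝓘(ℝ, E) x,
              (SolvesMotion Ω S' S H x v ↔ ∃ l ∈ multipliers Ω φ H x,
                v = hamField Ω H x + ∑ i, l i • hamField Ω (φ (Sum.inl i)) x) ∧
              (SolvesMotion Ω S' S H x v ↔ ∃! l : {i // i ∉ Set.range σ} → ℝ,
                v = diracField Ω χ (abridgedEnergy φ σ H l) x) ∧
              (SolvesMotion Ω S' S H x v ↔ ∃! l : {i // i ∉ Set.range σ} → ℝ,
                ∀ F : P → ℝ, ContMDiffAt 𝓘(ℝ, E) 𝓘(ℝ, ℝ) ∞ F x →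
                  mvfderiv 𝓘(ℝ, E) F x v = diracBracket Ω χ F H x
                    + ∑ i, l i * diracBracket Ω χ F (φ (Sum.inl i.1)) x)) ∧
            -- and it agrees on `S` with the field of the total energy `H + ∑ Lⁱ φ i`
            ((∀ x ∈ S ∩ W, (multipliers Ω φ H x).Nonempty) →
              (∀ l : {i // i ∉ Set.range σ} → ℝ, ∃ L : Fin p → P → ℝ,
                (∀ i, SmoothOn E (L i) W) ∧ (∀ i : {i // i ∉ Set.range σ}, ∀ x ∈ W, L i x = l i) ∧
                ∀ x ∈ S ∩ W, (fun i => L i x) ∈ multipliers Ω φ H x) ∧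
              ∀ L : Fin p → P → ℝ, (∀ i, SmoothOn E (L i) W) →
                (∀ x ∈ S ∩ W, (fun i => L i x) ∈ multipliers Ω φ H x) →
                ∀ x ∈ S ∩ W,
                  hamField Ω (fun y => H y + ∑ i, L i y * φ (Sum.inl i) y) x
                    = diracField Ω χ (abridgedEnergy φ σ H (fun i => L i x)) x ∧
                  diracField Ω χ (fun y => H y + ∑ i, L i y * φ (Sum.inl i) y) x
                    = diracField Ω χ (abridgedEnergy φ σ H (fun i => L i x)) x)) := by
  have hprimary : ∀ x₀ ∈ S, ∃ (σ : Fin s' ↪ Fin p) (V : Set P), IsOpen V ∧ x₀ ∈ V ∧ V ⊆ U ∧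
      ∀ x ∈ S ∩ V, LinearIndependent ℝ
        (fun k j => bracketMatrix Ω (primarySecond φ σ) φ x k j) := fun x₀ hx₀ =>
    exists_primary_second_class hS hx₀ (hΦ' x₀ hx₀)
  refine ⟨hprimary, fun σ V hV hVU hσ =>
    ⟨exists_primaryFirst hS' hS hΦ' hV hVU hσ, fun α hα hfc => ⟨fun x₀ hx₀ =>
      exists_adapted_complete_set hS' hS hΦ hΦ' hV hVU hσ hα hfc hx₀, ?_⟩⟩⟩
  rintro W t τ ψ'' hW hWV hC χ rfl H hH hHψ
  have hWU := hWV.trans hVU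
  have hφ := fun i => (hS.smooth i).mono hWU
  have hαW : ∀ i k, SmoothOn E (α i k) W := fun i k => (hα i k).mono hWV
  have hfcW := fun i => (hfc i).mono hWV
  have hfield := fun (x : P) (hx : x ∈ W) (l : {i // i ∉ Set.range σ} → ℝ) (F : P → ℝ) =>
    mvfderiv_diracField_abridgedEnergy (Ω := Ω)
      (Sum.elim (primarySecond φ σ) (secondarySecond φ τ)) hW hφ hH hx l F
  have htangent : ∀ x ∈ S ∩ W, ∀ l : {i // i ∉ Set.range σ} → ℝ,
      diracField Ω (Sum.elim (primarySecond φ σ) (secondarySecond φ τ))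
        (abridgedEnergy φ σ H l) x ∈ tangentTo E (S ∩ W) x := fun x hx l =>
    diracField_abridgedEnergy_mem_tangentTo hC hS hWU hH hx
      (Sum.forall.2 ⟨(hHψ x hx).1, (hHψ x hx).2⟩) l
  refine ⟨fun x hx l => ⟨diracField_abridgedEnergy _ hW hφ hH hx l, fun F _ => hfield x hx l F⟩,
    fun x hx l => ⟨tangentTo_mono Set.inter_subset_left x (htangent x hx l),
      fun F G hF hG hFG => ?_⟩, fun x hx hne v => ?_, fun hne =>
    ⟨exists_smooth_multipliers hS hW hWU (fun x hx => hσ x ⟨hx.1, hWV hx.2⟩) hαW hfcW hH hne,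
      fun L hL hLm x hx => total_energy_fields hC hS hWU hH hL hx (hLm x hx)⟩⟩
  -- Both sides are derivatives along the same vector. As F and G agree only on S ∩ W, the tangency
  -- used is to S ∩ W rather than to S.
  · rw [← hfield x hx.2, ← hfield x hx.2]
    have hF' := mdifferentiableAt_of_contMDiffAt hF
    have hG' := mdifferentiableAt_of_contMDiffAt hG
    have h1 := mvfderiv_eq_zero_of_mem_tangentTo (hF'.sub hG')
      (Filter.Eventually.of_forall fun y hy => sub_eq_zero.2 (hFG y hy)) (htangent x hx l)
    rw [mvfderiv_sub hF' hG'] at h1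
    exact sub_eq_zero.1 h1
  · have hmotion := solvesMotion_iff_exists_diracField hC hS' hS hWU hαW hH hx hne (v := v)
    refine ⟨solvesMotion_iff_exists_multipliers hS' hS hx.1, hmotion, hmotion.trans ?_⟩
    simp only [eq_iff_forall_mvfderiv_eq (v := v), hfield x hx.2]
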